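/- Let $\mathbb S=\mathbb R/2\pi\mathbb Z$ with Lebesgue measure of total mass $2\pi$, and for $G\in L_1(\mathbb S)$ let $\langle G\rangle=\frac1{2\pi}\int_0^{2\pi}G\,dx$. For a measurable control $u$ with $|u|\le1$ a.e. on $[0,T]$ consider the system $$\dot F=-F_x+u(t)\,\delta(x),\qquad \dot f=-\frac1{2\pi}\int_0^{2\pi}F\,dx,\qquad (F,f)|_{t=0}=(0,0),$$ for $F(t)\in L_\infty(\mathbb S)$ and $f(t)\in\mathbb R$, where $\delta$ is the Dirac function at $0\in\mathbb S$ and the first equation is understood in the weak sense: for every smooth $2\pi$-periodic $\Phi$ the function $t\mapsto\langle F(t),\Phi\rangle_{L_2}=\int_0^{2\pi}F(t)\Phi\,dx$ is continuous on $[0,T]$ and $$\langle F(t),\Phi\rangle_{L_2}=\int_0^t\big(\langle F(s),\Phi'\rangle_{L_2}+u(s)\Phi(0)\big)\,ds ,\qquad t\in[0,T].$$ Let $D(T)\subset L_\infty(\mathbb S)\times\mathbb R$ be the set of states $(F(T),f(T))$ reached at time $T$ in this way, over all such controls, and let $$T(F,f)=\inf\{T\ge0:(F,f)\in D(T)\}$$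 be the minimal reach time. **Theorem.** There exists a constant $C>0$ such that for all $(F,f)\in L_\infty(\mathbb S)\times\mathbb R$ with $\|F\|_{L_\infty}+|f|^{1/2}\ge C$ the following holds. The state $(F,f)$ is reachable in some finite time; the equation $$2\,\big|2f+T_1\langle F\rangle\big|=\frac{T_1^2}{2\pi}-2\pi\langle F^2\rangle$$ has a unique positive solution $T_1=T_1(F,f)$; and, with $T_0(F,f)=2\pi\|F\|_{L_\infty}$, $$1-C\big(\|F\|_{L_\infty}+|f|^{1/2}\big)^{-1/2}\le\frac{T(F,f)}{\max\{T_0(F,f),T_1(F,f)\}}\le1+C\big(\|F\|_{L_\infty}+|f|^{1/2}\big)^{-1}.$$ -/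

import Mathlib

open MeasureTheory Set
open scoped Real ENNReal ContDiff

noncomputable section

instance twoPiPosFact : Fact ((0 : ℝ) < 2 * π) := ⟨Real.two_pi_pos⟩

/-- The circle `ℝ / 2πℤ`, carrying Lebesgue measure of total mass `2π`. -/
abbrev Circ : Type := AddCircle (2 * π)

/-- The Banach space `L_∞` of the circle; its norm is the essential supremum. -/
abbrev LInf : Type := Lp ℝ ∞ (volume : Measure Circ)

/-- The mean value `(1 / 2π) ∫ G dx` over the circle. -/
def circMean (G : Circ → ℝ) : ℝ := (2 * π)⁻¹ * ∫ x, G x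

/-- Test functions on the circle: smooth `2π`-periodic functions on the line. -/
def IsTestFunction (Φ : ℝ → ℝ) : Prop :=
  ContDiff ℝ ∞ Φ ∧ Function.Periodic Φ (2 * π)

/-- The pairing `∫₀^{2π} F(x) Φ(x) dx`. -/
def pairing (F : LInf) (Φ : ℝ → ℝ) : ℝ :=
  ∫ x in (0 : ℝ)..(2 * π), F (x : Circ) * Φ x

/-- Admissible controls on `[0, T]`: measurable functions with `|u| ≤ 1` almost everywhere. -/
def IsAdmissibleControl (T : ℝ) (u : ℝ → ℝ) : Prop :=
  AEMeasurable u (volume.restrict (Icc 0 T)) ∧ ∀ᵐ t ∂(volume.restrict (Icc 0 T)), |u t| ≤ 1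

/-- `(F, f)` solves, on the time interval `[0, T]` and from zero initial data, the system
`∂F/∂t = -∂F/∂x + u(t) δ(x)`, `df/dt = -(1 / 2π) ∫ F dx` on the circle.
The first equation is meant in the sense of distributions in `x`: since
`⟨-∂F/∂x + u δ, Φ⟩ = ⟨F, Φ'⟩ + u Φ(0)`, integrating in time gives the identity `transport`. -/
structure IsTrajectory (T : ℝ) (u : ℝ → ℝ) (F : ℝ → LInf) (f : ℝ → ℝ) : Prop where
  F_init : F 0 = 0
  f_init : f 0 = 0
  weak_continuous : ∀ Φ : ℝ → ℝ, IsTestFunction Φ →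
    ContinuousOn (fun t => pairing (F t) Φ) (Icc 0 T)
  transport : ∀ Φ : ℝ → ℝ, IsTestFunction Φ → ∀ t ∈ Icc 0 T,
    pairing (F t) Φ = pairing (F 0) Φ +
      ∫ s in (0 : ℝ)..t, (pairing (F s) (deriv Φ) + u s * Φ 0)
  average : ∀ t ∈ Icc 0 T, f t = f 0 + ∫ s in (0 : ℝ)..t, -circMean (F s)

/-- The set `D(T)` of the states that can be reached from zero in time `T`. -/
def reachableSet (T : ℝ) : Set (LInf × ℝ) :=
  {p | ∃ (u : ℝ → ℝ) (F : ℝ → LInf) (f : ℝ → ℝ),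
    IsAdmissibleControl T u ∧ IsTrajectory T u F f ∧ F T = p.1 ∧ f T = p.2}

/-- The times `T ≥ 0` in which the state `(F, f)` can be reached from zero. -/
def reachTimes (F : LInf) (f : ℝ) : Set ℝ :=
  {T | 0 ≤ T ∧ (F, f) ∈ reachableSet T}

/-- The minimal reach time of the state `(F, f)`. -/
def minReachTime (F : LInf) (f : ℝ) : ℝ := sInf (reachTimes F f)

/-- `T₀(F, f) = 2π ‖F‖_∞`. -/
def timeT0 (F : LInf) : ℝ := 2 * π * ‖F‖

/-- `t` is a positive root of `2 |2 f + t ⟨F⟩| = t² / (2π) - 2π ⟨F²⟩`. -/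
def IsTimeT1 (F : LInf) (f t : ℝ) : Prop :=
  0 < t ∧ 2 * |2 * f + t * circMean F| = t ^ 2 / (2 * π) - 2 * π * circMean (fun x => F x ^ 2)

/-- The size `‖F‖_∞ + |f|^{1/2}` of a state. -/
def stateSize (F : LInf) (f : ℝ) : ℝ := ‖F‖ + |f| ^ (1 / 2 : ℝ)

end

noncomputable section

/-! Read the control backwards, `w(s) = u(T - s)`. Transport wraps `w` around the circle, so F(T) at
x is the sum of w over the fibre x + 2πℕ, while -2πf(T) is the first moment of w. As weak solutions
are unique, reachability is a moment problem (`mem_reachableSet_iff`): find w supported in [0, T]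
with |w| ≤ 1, fibre sums F and first moment -2πf.

Centred at T/2, the moment becomes -π(2f + T⟨F⟩). With the fibre sums fixed it is extremal when w is
bang-bang on each fibre with one switch, and its largest modulus is T²/4 - π²⟨F²⟩ up to lower-order
terms. Equality of |π(2f + T⟨F⟩)| with this main term is the equation for T₁; the constraint |w| ≤ 1
on fibres of about T/(2π) points gives T₀.

Necessity (`bounds_of_mem_reachableSet`) follows from a Lagrange multiplier on each fibre, with an
error O(T). Sufficiency (`mem_reachableSet_of_le`) interpolates between the two extremal profiles
over N full turns. Write M = max(T₀, T₁). Beyond M + 4π the sufficient condition holds, and rounding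
to full turns costs 2π more (`exists_mem_reachTimes`). In the other direction, the parabola T²/4 -
π|⟨F⟩|T may be stationary at T = 2π|⟨F⟩|, so the O(T) error only yields T₁ - T = O(√M)
(`root_sub_sq_le`); hence the exponent -1/2. Finally `stateSize_le` bounds the state size by M,
which turns these errors into relative ones. -/

/-! ### Wrapping functions on the line around the circle -/

/-- The representative in `(0, 2π]` of a point of the circle. -/
def circRep (z : Circ) : ℝ := (AddCircle.equivIoc (2 * π) 0 z : ℝ)

/-- The sum of `w` over the first `K` points of the fibre `x + 2πℕ`. -/
def fibreSum (K : ℕ) (w : ℝ → ℝ) (x : ℝ) : ℝ := ∑ k ∈ Finset.range K, w (x + 2 * π * k)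

/-- The function on the circle obtained by wrapping `w` around it `K` times. -/
def wrap (K : ℕ) (w : ℝ → ℝ) (z : Circ) : ℝ := fibreSum K w (circRep z)

lemma circRep_coe {x : ℝ} (hx : x ∈ Ioc 0 (2 * π)) : circRep (x : Circ) = x := by
  have h : x ∈ Ioc 0 (0 + 2 * π) := by simpa using hx
  simp [circRep, AddCircle.equivIoc_coe_of_mem h]

lemma circRep_mem (z : Circ) : circRep z ∈ Ioc 0 (2 * π) := by
  simpa [circRep] using (AddCircle.equivIoc (2 * π) 0 z).2

lemma measurable_circRep : Measurable circRep :=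
  measurable_subtype_coe.comp (AddCircle.measurableEquivIoc (2 * π) 0).measurable

lemma measurable_fibreSum {K : ℕ} {w : ℝ → ℝ} (hw : Measurable w) :
    Measurable (fibreSum K w) := by
  unfold fibreSum
  fun_prop

lemma abs_fibreSum_le {K : ℕ} {w : ℝ → ℝ} (hw : ∀ s, |w s| ≤ 1) (x : ℝ) :
    |fibreSum K w x| ≤ K := by
  refine (Finset.abs_sum_le_sum_abs _ _).trans ?_
  simpa using Finset.sum_le_sum (s := Finset.range K) fun k _ => hw (x + 2 * π * k)

lemma memLp_wrap {K : ℕ} {w : ℝ → ℝ} (hw : Measurable w) (hb : ∀ s, |w s| ≤ 1) :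
    MemLp (wrap K w) ∞ (volume : Measure Circ) :=
  memLp_top_of_bound ((measurable_fibreSum hw).comp measurable_circRep).aestronglyMeasurable K
    (.of_forall fun _ => abs_fibreSum_le hb _)

lemma ae_restrict_Ioc_of_ae_circ {p : Circ → Prop} (h : ∀ᵐ z, p z) :
    ∀ᵐ x : ℝ ∂volume.restrict (Ioc 0 (2 * π)), p (x : Circ) := by
  have := (AddCircle.measurePreserving_mk (2 * π) 0).quasiMeasurePreserving.ae h
  simpa using this

lemma circMean_eq_intervalIntegral (G : Circ → ℝ) :
    circMean G = (2 * π)⁻¹ * ∫ x in (0 : ℝ)..2 * π, G (x : Circ) := by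
  rw [circMean, ← AddCircle.intervalIntegral_preimage (2 * π) 0 G, zero_add]

lemma intervalIntegral_congr_circ {g h : ℝ → ℝ}
    (hgh : ∀ᵐ x ∂volume.restrict (Ioc 0 (2 * π)), g x = h x) :
    ∫ x in (0 : ℝ)..2 * π, g x = ∫ x in (0 : ℝ)..2 * π, h x := by
  rw [intervalIntegral.integral_of_le Real.two_pi_pos.le,
    intervalIntegral.integral_of_le Real.two_pi_pos.le]
  exact integral_congr_ae hgh

lemma intervalIntegrable_of_bound {w : ℝ → ℝ} (hw : Measurable w) {C : ℝ}
    (hb : ∀ s, |w s| ≤ C) (a b : ℝ) : IntervalIntegrable w volume a b := by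
  rw [intervalIntegrable_iff]
  exact Measure.integrableOn_of_bounded (M := C) (by simp) hw.aestronglyMeasurable
    (.of_forall hb)

lemma intervalIntegrable_mul_continuous {w φ : ℝ → ℝ} (hw : Measurable w)
    (hb : ∀ s, |w s| ≤ 1) (hφ : Continuous φ) (a b : ℝ) :
    IntervalIntegrable (fun s => w s * φ s) volume a b :=
  (intervalIntegrable_of_bound hw hb a b).mul_continuousOn hφ.continuousOn

lemma integral_fibreSum {h : ℝ → ℝ} (hh : ∀ a b, IntervalIntegrable h volume a b) (K : ℕ) :
    ∫ x in (0 : ℝ)..2 * π * K, h x = ∫ x in (0 : ℝ)..2 * π, fibreSum K h x := by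
  unfold fibreSum
  rw [intervalIntegral.integral_finsetSum]
  · have := intervalIntegral.sum_integral_adjacent_intervals (f := h) (μ := volume)
      (a := fun k : ℕ => 2 * π * k) (n := K) fun k _ => hh _ _
    simp only [Nat.cast_zero, mul_zero] at this
    rw [← this]
    refine Finset.sum_congr rfl fun k _ => ?_
    rw [intervalIntegral.integral_comp_add_right (fun x => h x)]
    congr 1 <;> push_cast <;> ring
  · intro k _
    have := (hh (0 + 2 * π * k) (2 * π + 2 * π * k)).comp_add_right (2 * π * k)
    simpa using this

lemma wrap_coe {K : ℕ} {w : ℝ → ℝ} {x : ℝ} (hx : x ∈ Ioc 0 (2 * π)) :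
    wrap K w (x : Circ) = fibreSum K w x := by
  rw [wrap, circRep_coe hx]

lemma ae_eq_fibreSum_of_ae_eq_wrap {K : ℕ} {w : ℝ → ℝ} {F : LInf}
    (hF : (F : Circ → ℝ) =ᵐ[volume] wrap K w) :
    ∀ᵐ x : ℝ ∂volume.restrict (Ioc 0 (2 * π)), F (x : Circ) = fibreSum K w x := by
  filter_upwards [ae_restrict_Ioc_of_ae_circ hF, ae_restrict_mem measurableSet_Ioc] with x h1 h2
  rw [h1, wrap_coe h2]

lemma pairing_eq_of_ae_eq_wrap {K : ℕ} {w Φ : ℝ → ℝ} (hw : Measurable w) (hb : ∀ s, |w s| ≤ 1)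
    (hΦ : Continuous Φ) (hp : Function.Periodic Φ (2 * π)) {F : LInf}
    (hF : (F : Circ → ℝ) =ᵐ[volume] wrap K w) :
    pairing F Φ = ∫ y in (0 : ℝ)..2 * π * K, w y * Φ y := by
  rw [integral_fibreSum (intervalIntegrable_mul_continuous hw hb hΦ), pairing]
  apply intervalIntegral_congr_circ
  filter_upwards [ae_eq_fibreSum_of_ae_eq_wrap hF] with x hx
  rw [hx, fibreSum, fibreSum, Finset.sum_mul]
  refine Finset.sum_congr rfl fun k _ => ?_
  have := hp.nat_mul k x
  rw [mul_comm (2 * π) (k : ℝ), this]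

/-- Fubini's theorem on a triangle for the kernel `φ' (r - s)`. -/
lemma integral_triangle {u φ φ' : ℝ → ℝ} (hu : Measurable u) (hb : ∀ s, |u s| ≤ 1)
    (hφ : ∀ x, HasDerivAt φ (φ' x) x) (hφ' : Continuous φ') {t : ℝ} (ht : 0 ≤ t) :
    IntervalIntegrable (fun r => ∫ s in (0 : ℝ)..r, u s * φ' (r - s)) volume 0 t ∧
    ∫ r in (0 : ℝ)..t, ∫ s in (0 : ℝ)..r, u s * φ' (r - s) =
      ∫ s in (0 : ℝ)..t, u s * (φ (t - s) - φ 0) := by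
  -- The triangle s ≤ r is encoded in the kernel, so that Fubini applies on a square.
  set μ : Measure ℝ := volume.restrict (Ioc 0 t) with hμ
  set g : ℝ → ℝ → ℝ := fun r s => if s ≤ r then u s * φ' (r - s) else 0 with hg
  obtain ⟨C, hC⟩ := (isCompact_Icc (a := (0 : ℝ)) (b := t)).exists_bound_of_continuousOn
    hφ'.continuousOn
  have hC0 : 0 ≤ C := (norm_nonneg _).trans (hC 0 (by simp [ht]))
  have hgm : Measurable (Function.uncurry g) := by
    apply Measurable.ite (measurableSet_le measurable_snd measurable_fst)
    · exact (hu.comp measurable_snd).mul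
        (hφ'.measurable.comp (measurable_fst.sub measurable_snd))
    · exact measurable_const
  have hgi : Integrable (Function.uncurry g) (μ.prod μ) := by
    refine Integrable.of_bound hgm.aestronglyMeasurable C ?_
    rw [hμ, Measure.prod_restrict]
    filter_upwards [ae_restrict_mem (measurableSet_Ioc.prod measurableSet_Ioc)] with p hp
    obtain ⟨⟨h1, h2⟩, h3, h4⟩ := hp
    simp only [Function.uncurry, hg]
    split_ifs with h
    · rw [norm_mul]
      have := hC (p.1 - p.2) ⟨by linarith, by linarith⟩
      calc ‖u p.2‖ * ‖φ' (p.1 - p.2)‖ ≤ 1 * C :=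
            mul_le_mul (hb _) this (norm_nonneg _) zero_le_one
        _ = C := one_mul C
    · simpa using hC0
  have h1 : ∀ᵐ r ∂μ, ∫ s, g r s ∂μ = ∫ s in (0 : ℝ)..r, u s * φ' (r - s) := by
    filter_upwards [ae_restrict_mem measurableSet_Ioc] with r hr
    have : g r = (Iic r).indicator fun s => u s * φ' (r - s) := by
      ext s; simp [hg, indicator]
    rw [this, integral_indicator measurableSet_Iic, hμ, Measure.restrict_restrict measurableSet_Iic,
      intervalIntegral.integral_of_le hr.1.le, Iic_inter_Ioc_of_le hr.2]
  have h2 : ∀ᵐ s ∂μ, ∫ r, g r s ∂μ = u s * (φ (t - s) - φ 0) := by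
    filter_upwards [ae_restrict_mem measurableSet_Ioc] with s hs
    have : (fun r => g r s) = (Ici s).indicator fun r => u s * φ' (r - s) := by
      ext r; simp [hg, indicator]
    rw [this, integral_indicator measurableSet_Ici, hμ, Measure.restrict_restrict measurableSet_Ici]
    have h3 : Ici s ∩ Ioc 0 t = Icc s t := by
      ext r; simp only [mem_inter_iff, mem_Ici, mem_Ioc, mem_Icc]
      exact ⟨fun h => ⟨h.1, h.2.2⟩, fun h => ⟨h.1, hs.1.trans_le h.1, h.2⟩⟩
    rw [h3, integral_Icc_eq_integral_Ioc, ← intervalIntegral.integral_of_le hs.2,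
      intervalIntegral.integral_const_mul]
    congr 1
    rw [intervalIntegral.integral_comp_sub_right (fun x => φ' x),
      intervalIntegral.integral_eq_sub_of_hasDerivAt (fun x _ => hφ x)
        (hφ'.intervalIntegrable _ _), sub_self]
  refine ⟨?_, ?_⟩
  · rw [intervalIntegrable_iff, uIoc_of_le ht]
    exact hgi.integral_prod_left.congr h1
  · rw [intervalIntegral.integral_of_le ht, intervalIntegral.integral_of_le ht,
      ← integral_congr_ae h1, ← integral_congr_ae h2]
    exact integral_integral_swap hgi

/-! ### Uniqueness of weak solutions by Fourier coefficients -/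

lemma LInf.integrable (F : LInf) : Integrable (F : Circ → ℝ) volume :=
  (Lp.memLp F).integrable le_top

lemma LInf.intervalIntegrable (F : LInf) :
    IntervalIntegrable (fun x : ℝ => F (x : Circ)) volume 0 (2 * π) := by
  rw [intervalIntegrable_iff, uIoc_of_le Real.two_pi_pos.le]
  have := (AddCircle.measurePreserving_mk (2 * π) 0).integrable_comp_of_integrable F.integrable
  simpa [Function.comp_def, IntegrableOn] using this

lemma pairing_const_mul (F : LInf) (a : ℝ) (Φ : ℝ → ℝ) :
    pairing F (fun x => a * Φ x) = a * pairing F Φ := by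
  rw [pairing, pairing, ← intervalIntegral.integral_const_mul]
  exact intervalIntegral.integral_congr fun x _ => by ring

lemma circMean_eq_pairing (F : LInf) : circMean F = (2 * π)⁻¹ * pairing F fun _ => 1 := by
  simp [circMean_eq_intervalIntegral, pairing]

lemma isTestFunction_cos (n : ℤ) : IsTestFunction fun x => Real.cos (n * x) :=
  ⟨by fun_prop, fun x => by
    show Real.cos (n * (x + 2 * π)) = _
    rw [mul_add]
    exact Real.cos_add_int_mul_two_pi _ _⟩

lemma isTestFunction_sin (n : ℤ) : IsTestFunction fun x => Real.sin (n * x) :=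
  ⟨by fun_prop, fun x => by
    show Real.sin (n * (x + 2 * π)) = _
    rw [mul_add]
    exact Real.sin_add_int_mul_two_pi _ _⟩

lemma deriv_cos_int_mul (n : ℤ) :
    deriv (fun x : ℝ => Real.cos (n * x)) = fun x => -(n : ℝ) * Real.sin (n * x) := by
  ext x
  have := ((hasDerivAt_id x).const_mul (n : ℝ)).cos.deriv
  simp only [id, mul_one] at this
  rw [this]; ring

lemma deriv_sin_int_mul (n : ℤ) :
    deriv (fun x : ℝ => Real.sin (n * x)) = fun x => (n : ℝ) * Real.cos (n * x) := by
  ext x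
  have := ((hasDerivAt_id x).const_mul (n : ℝ)).sin.deriv
  simp only [id, mul_one] at this
  rw [this]; ring

lemma fourierCoeff_ofReal (F : LInf) (n : ℤ) :
    fourierCoeff (fun z : Circ => ((F z : ℝ) : ℂ)) n =
      (1 / (2 * π)) • ((pairing F (fun x => Real.cos (n * x)) : ℂ) -
        Complex.I * (pairing F (fun x => Real.sin (n * x)) : ℂ)) := by
  have hi (Φ : ℝ → ℝ) (hΦ : Continuous Φ) :
      IntervalIntegrable (fun x : ℝ => ((F (x : Circ) * Φ x : ℝ) : ℂ)) volume 0 (2 * π) := by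
    have := F.intervalIntegrable.mul_continuousOn (g := Φ) hΦ.continuousOn
    exact ⟨this.1.ofReal, this.2.ofReal⟩
  rw [fourierCoeff_eq_intervalIntegral _ n 0, zero_add, pairing, pairing,
    ← intervalIntegral.integral_ofReal, ← intervalIntegral.integral_ofReal,
    ← intervalIntegral.integral_const_mul, ← intervalIntegral.integral_sub]
  · congr 1
    refine intervalIntegral.integral_congr fun x _ => ?_
    simp only [fourier_coe_apply, smul_eq_mul]
    have h : 2 * (π : ℂ) * Complex.I * ((-n : ℤ) : ℂ) * (x : ℂ) / ((2 * π : ℝ) : ℂ) =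
        ((-(n * x) : ℝ) : ℂ) * Complex.I := by
      have : (π : ℂ) ≠ 0 := by exact_mod_cast Real.pi_ne_zero
      push_cast
      field_simp
    rw [h, Complex.exp_mul_I, ← Complex.ofReal_cos, ← Complex.ofReal_sin, Real.cos_neg,
      Real.sin_neg]
    push_cast
    ring
  · exact hi _ (by fun_prop)
  · exact (hi _ (by fun_prop)).const_mul _

lemma LInf.eq_of_trigonometric_pairings {F G : LInf}
    (hc : ∀ n : ℤ, pairing F (fun x => Real.cos (n * x)) = pairing G (fun x => Real.cos (n * x)))
    (hs : ∀ n : ℤ, pairing F (fun x => Real.sin (n * x)) = pairing G (fun x => Real.sin (n * x))) :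
    F = G := by
  have hm (H : LInf) : MemLp (fun z : Circ => ((H z : ℝ) : ℂ)) 2 AddCircle.haarAddCircle := by
    rw [MeasureTheory.memLp_haarAddCircle_iff]
    exact ((Lp.memLp H).mono_exponent le_top).ofReal
  have hL : (hm F).toLp = (hm G).toLp := by
    apply fourierBasis.repr.injective
    ext n
    rw [fourierBasis_repr, fourierBasis_repr, fourierCoeff_congr_ae (hm F).coeFn_toLp,
      fourierCoeff_congr_ae (hm G).coeFn_toLp, fourierCoeff_ofReal, fourierCoeff_ofReal, hc, hs]
  have h := (MemLp.toLp_eq_toLp_iff (hm F) (hm G)).1 hL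
  have h' : (fun z : Circ => ((F z : ℝ) : ℂ)) =ᵐ[volume] fun z => ((G z : ℝ) : ℂ) :=
    Measure.ae_smul_measure h (ENNReal.ofReal (2 * π))
  refine Lp.ext ?_
  filter_upwards [h'] with z hz
  exact_mod_cast hz

/-- The integral form of the rotation system `c' = -n s`, `s' = n c` has only the zero solution. -/
lemma rotation_system_unique {T n : ℝ} {c s : ℝ → ℝ} (hc : ContinuousOn c (Icc 0 T))
    (hs : ContinuousOn s (Icc 0 T))
    (hc' : ∀ t ∈ Icc 0 T, c t = ∫ r in (0 : ℝ)..t, -n * s r)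
    (hs' : ∀ t ∈ Icc 0 T, s t = ∫ r in (0 : ℝ)..t, n * c r) :
    ∀ t ∈ Icc 0 T, c t = 0 ∧ s t = 0 := by
  have key {g h : ℝ → ℝ} (hh : ContinuousOn h (Icc 0 T))
      (hg : ∀ t ∈ Icc 0 T, g t = ∫ r in (0 : ℝ)..t, h r) {x : ℝ} (hx : x ∈ Ico 0 T) :
      HasDerivWithinAt g (h x) (Ici x) x := by
    have hN : Icc 0 T ∈ nhdsWithin x (Ici x) := Icc_mem_nhdsGE_of_mem hx
    have hN' : Icc 0 T ∈ nhdsWithin x (Ioi x) := nhdsWithin_mono _ Ioi_subset_Ici_self hN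
    have hi : IntervalIntegrable h volume 0 x :=
      (hh.mono (by rw [uIcc_of_le hx.1]; exact Icc_subset_Icc_right hx.2.le)).intervalIntegrable
    have hd : HasDerivWithinAt (fun t => ∫ r in (0 : ℝ)..t, h r) (h x) (Ici x) x := by
      refine intervalIntegral.integral_hasDerivWithinAt_right hi (t := Ioi x)
        ⟨Icc 0 T, hN', hh.aestronglyMeasurable measurableSet_Icc⟩ ?_
      exact (hh x (Ico_subset_Icc_self hx)).mono_of_mem_nhdsWithin hN'
    refine hd.congr_of_eventuallyEq ?_ (hg x (Ico_subset_Icc_self hx))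
    filter_upwards [hN] with t ht using hg t ht
  intro t ht
  have h0 : (0 : ℝ) ∈ Icc 0 T := ⟨le_rfl, ht.1.trans ht.2⟩
  -- Rotations preserve c² + s², which vanishes at time 0.
  have h := constant_of_has_deriv_right_zero (f := fun t => c t ^ 2 + s t ^ 2) (a := 0) (b := T)
    ((hc.pow 2).add (hs.pow 2)) (fun x hx => by
      have h1 := key (h := fun r => -n * s r) (hs.const_smul (-n)) hc' hx
      have h2 := key (h := fun r => n * c r) (hc.const_smul n) hs' hx
      refine ((h1.pow 2).add (h2.pow 2)).congr_deriv ?_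
      push_cast; ring) t ht
  have hc0 := hc' 0 h0
  have hs0 := hs' 0 h0
  simp only [intervalIntegral.integral_same] at hc0 hs0
  simp only [hc0, hs0] at h
  constructor <;> nlinarith [sq_nonneg (c t), sq_nonneg (s t)]

lemma IsAdmissibleControl.intervalIntegrable {T : ℝ} {u : ℝ → ℝ} (hu : IsAdmissibleControl T u)
    {t : ℝ} (ht : t ∈ Icc 0 T) : IntervalIntegrable u volume 0 t := by
  rw [intervalIntegrable_iff, uIoc_of_le ht.1]
  have : IntegrableOn u (Icc 0 T) :=
    Integrable.of_bound hu.1.aestronglyMeasurable 1 hu.2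
  exact this.mono_set (Ioc_subset_Icc_self.trans (Icc_subset_Icc_right ht.2))

lemma IsTrajectory.pairing_sub {T : ℝ} {u : ℝ → ℝ} {F G : ℝ → LInf} {f g : ℝ → ℝ}
    (hu : IsAdmissibleControl T u) (hF : IsTrajectory T u F f) (hG : IsTrajectory T u G g)
    {Φ : ℝ → ℝ} (hΦ : IsTestFunction Φ) (hΦ' : IsTestFunction (deriv Φ)) {t : ℝ}
    (ht : t ∈ Icc 0 T) :
    pairing (F t) Φ - pairing (G t) Φ =
      ∫ r in (0 : ℝ)..t, (pairing (F r) (deriv Φ) - pairing (G r) (deriv Φ)) := by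
  have hi {H : ℝ → LInf} {h : ℝ → ℝ} (hH : IsTrajectory T u H h) :
      IntervalIntegrable (fun s => pairing (H s) (deriv Φ) + u s * Φ 0) volume 0 t := by
    refine IntervalIntegrable.add ?_ ((hu.intervalIntegrable ht).mul_const _)
    refine ((hH.weak_continuous _ hΦ').mono ?_).intervalIntegrable
    rw [uIcc_of_le ht.1]; exact Icc_subset_Icc_right ht.2
  rw [hF.transport Φ hΦ t ht, hG.transport Φ hΦ t ht, hF.F_init, hG.F_init, add_sub_add_left_eq_sub,
    ← intervalIntegral.integral_sub (hi hF) (hi hG)]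
  exact intervalIntegral.integral_congr fun r _ => by ring

lemma IsTestFunction.const_mul {Φ : ℝ → ℝ} (hΦ : IsTestFunction Φ) (a : ℝ) :
    IsTestFunction fun x => a * Φ x :=
  ⟨contDiff_const.mul hΦ.1, fun x => by simp only [hΦ.2 x]⟩

/-- The source term cancels in the difference of two solutions. Testing it with cos(nx) and sin(nx)
gives a closed rotation system for each n, so all Fourier coefficients vanish. -/
lemma IsTrajectory.unique {T : ℝ} {u : ℝ → ℝ} {F G : ℝ → LInf} {f g : ℝ → ℝ}
    (hu : IsAdmissibleControl T u) (hF : IsTrajectory T u F f) (hG : IsTrajectory T u G g)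
    {t : ℝ} (ht : t ∈ Icc 0 T) : F t = G t := by
  have h (n : ℤ) := rotation_system_unique (T := T) (n := n)
    (c := fun t => pairing (F t) (fun x => Real.cos (n * x)) -
      pairing (G t) (fun x => Real.cos (n * x)))
    (s := fun t => pairing (F t) (fun x => Real.sin (n * x)) -
      pairing (G t) (fun x => Real.sin (n * x)))
    ((hF.weak_continuous _ (isTestFunction_cos n)).sub
      (hG.weak_continuous _ (isTestFunction_cos n)))
    ((hF.weak_continuous _ (isTestFunction_sin n)).sub
      (hG.weak_continuous _ (isTestFunction_sin n)))
    (fun t ht => by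
      rw [hF.pairing_sub hu hG (isTestFunction_cos n)
        (by rw [deriv_cos_int_mul]; exact (isTestFunction_sin n).const_mul _) ht]
      simp only [deriv_cos_int_mul, pairing_const_mul, mul_sub])
    (fun t ht => by
      rw [hF.pairing_sub hu hG (isTestFunction_sin n)
        (by rw [deriv_sin_int_mul]; exact (isTestFunction_cos n).const_mul _) ht]
      simp only [deriv_sin_int_mul, pairing_const_mul, mul_sub]) t ht
  exact LInf.eq_of_trigonometric_pairings (fun n => sub_eq_zero.1 (h n).1)
    fun n => sub_eq_zero.1 (h n).2

lemma IsTrajectory.congr_control {T : ℝ} {u v : ℝ → ℝ} {F : ℝ → LInf} {f : ℝ → ℝ}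
    (h : IsTrajectory T u F f) (huv : u =ᵐ[volume.restrict (Icc 0 T)] v) :
    IsTrajectory T v F f where
  F_init := h.F_init
  f_init := h.f_init
  weak_continuous := h.weak_continuous
  average := h.average
  transport Φ hΦ t ht := by
    rw [h.transport Φ hΦ t ht, intervalIntegral.integral_of_le ht.1,
      intervalIntegral.integral_of_le ht.1]
    congr 1
    apply integral_congr_ae
    filter_upwards [ae_restrict_of_ae_restrict_of_subset
      (Ioc_subset_Icc_self.trans (Icc_subset_Icc_right ht.2)) huv] with s hs
    rw [hs]

/-! ### The explicit solution and the reduction to a moment problem -/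

/-- The solution at time t is y ↦ u(t - y) wrapped K times. Since t ≤ 2πK the K turns cover all past
times, and the part of the window before time 0 contributes nothing. -/
lemma exists_isTrajectory {T : ℝ} {K : ℕ} {u : ℝ → ℝ} (hT0 : 0 ≤ T) (hT : T ≤ 2 * π * K)
    (hu : Measurable u) (hb : ∀ s, |u s| ≤ 1) (hneg : ∀ s < 0, u s = 0) :
    ∃ (F : ℝ → LInf) (f : ℝ → ℝ), IsTrajectory T u F f ∧
      (∀ t, (F t : Circ → ℝ) =ᵐ[volume] wrap K fun y => u (t - y)) ∧
      f T = -((2 * π)⁻¹ * ∫ s in (0 : ℝ)..T, u s * (T - s)) := by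
  have hm (t : ℝ) : Measurable fun y => u (t - y) := by fun_prop
  set F : ℝ → LInf := fun t => (memLp_wrap (K := K) (hm t) fun _ => hb _).toLp with hFdef
  have hF (t : ℝ) : (F t : Circ → ℝ) =ᵐ[volume] wrap K fun y => u (t - y) :=
    MemLp.coeFn_toLp _
  have hpair {Φ : ℝ → ℝ} (hΦ : Continuous Φ) (hp : Function.Periodic Φ (2 * π)) {t : ℝ}
      (ht : t ∈ Icc 0 T) : pairing (F t) Φ = ∫ s in (0 : ℝ)..t, u s * Φ (t - s) := by
    rw [pairing_eq_of_ae_eq_wrap (hm t) (fun _ => hb _) hΦ hp (hF t)]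
    have h1 := intervalIntegral.integral_comp_sub_left (a := 0) (b := 2 * π * K)
      (fun s => u s * Φ (t - s)) t
    simp only [sub_sub_cancel, sub_zero] at h1
    have hi (a b : ℝ) : IntervalIntegrable (fun s => u s * Φ (t - s)) volume a b :=
      intervalIntegrable_mul_continuous hu hb (by fun_prop) a b
    have h2 : ∫ s in (t - 2 * π * K)..0, u s * Φ (t - s) = 0 := by
      rw [intervalIntegral.integral_of_le (by linarith [ht.2]), integral_Ioc_eq_integral_Ioo,
        setIntegral_congr_fun (g := fun _ => (0 : ℝ)) measurableSet_Ioo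
          fun s hs => by simp [hneg s hs.2]]
      simp
    rw [h1, ← intervalIntegral.integral_add_adjacent_intervals (hi _ 0) (hi 0 _), h2, zero_add]
  have hF0 : F 0 = 0 := by
    refine Lp.ext ?_
    filter_upwards [hF 0, Lp.coeFn_zero ℝ ∞ (volume : Measure Circ)] with z h1 h2
    rw [h1, h2, wrap, fibreSum]
    refine Finset.sum_eq_zero fun k _ => hneg _ ?_
    -- Representatives in (0, 2π] are strictly positive, so at t = 0 the control is read at negative
    -- times only.
    have h3 := (circRep_mem z).1
    have : 0 ≤ 2 * π * k := by positivity
    linarith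
  have htri {Φ : ℝ → ℝ} (hΦ : IsTestFunction Φ) {t : ℝ} (ht : 0 ≤ t) :=
    integral_triangle (φ := Φ) (φ' := deriv Φ) hu hb
      (fun x => (hΦ.1.differentiable (by simp) x).hasDerivAt)
      (hΦ.1.continuous_deriv (by simp)) ht
  have hper {Φ : ℝ → ℝ} (hΦ : IsTestFunction Φ) : Function.Periodic (deriv Φ) (2 * π) := by
    intro x
    have : (fun y => Φ (y + 2 * π)) = Φ := funext hΦ.2
    rw [← deriv_comp_add_const, this]
  have hui (a b : ℝ) (c : ℝ) : IntervalIntegrable (fun s => u s * c) volume a b :=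
    (intervalIntegrable_of_bound hu hb a b).mul_const c
  have htr {Φ : ℝ → ℝ} (hΦ : IsTestFunction Φ) {t : ℝ} (ht : t ∈ Icc 0 T) :
      pairing (F t) Φ = ∫ r in (0 : ℝ)..t,
        ((∫ s in (0 : ℝ)..r, u s * deriv Φ (r - s)) + u r * Φ 0) := by
    obtain ⟨h1, h2⟩ := htri hΦ ht.1
    have h3 : IntervalIntegrable (fun s => u s * Φ (t - s)) volume 0 t :=
      intervalIntegrable_mul_continuous hu hb (by have := hΦ.1.continuous; fun_prop) _ _
    rw [intervalIntegral.integral_add h1 (hui _ _ _), h2, hpair hΦ.1.continuous hΦ.2 ht]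
    simp only [mul_sub]
    rw [intervalIntegral.integral_sub h3 (hui _ _ _)]
    ring
  refine ⟨F, fun t => ∫ s in (0 : ℝ)..t, -circMean (F s), ⟨hF0, by simp, ?_, ?_, ?_⟩, hF, ?_⟩
  · intro Φ hΦ
    refine ContinuousOn.congr ?_ fun t ht => htr hΦ ht
    have h := ((htri hΦ hT0).1.add (hui 0 T (Φ 0)))
    have := intervalIntegral.continuousOn_primitive_interval (a := 0) (b := T)
      (by rw [uIcc_of_le hT0]; exact (intervalIntegrable_iff_integrableOn_Icc_of_le hT0).1 h)
    rwa [uIcc_of_le hT0] at this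
  · intro Φ hΦ t ht
    have h0 : pairing (F 0) Φ = 0 := by
      rw [hpair hΦ.1.continuous hΦ.2 ⟨le_rfl, hT0⟩, intervalIntegral.integral_same]
    rw [h0, zero_add, htr hΦ ht]
    refine intervalIntegral.integral_congr fun r hr => ?_
    rw [uIcc_of_le ht.1] at hr
    rw [hpair (hΦ.1.continuous_deriv (by simp)) (hper hΦ) ⟨hr.1, hr.2.trans ht.2⟩]
  · intro t _
    simp
  -- The kernel φ = id makes the triangle identity the double integral of u that gives f.
  · have h := (integral_triangle (φ := fun x => x) (φ' := fun _ => 1) hu hb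
      (fun x => hasDerivAt_id x) continuous_const hT0).2
    simp only [sub_zero] at h
    rw [← h, ← intervalIntegral.integral_const_mul, ← intervalIntegral.integral_neg]
    refine intervalIntegral.integral_congr fun r hr => ?_
    rw [uIcc_of_le hT0] at hr
    rw [circMean_eq_pairing, hpair continuous_const (fun _ => rfl) hr]

lemma integral_eq_of_eq_zero_off {w φ : ℝ → ℝ} {T L : ℝ} (hTL : T ≤ L)
    (hi : ∀ a b, IntervalIntegrable (fun s => φ s * w s) volume a b)
    (hw : ∀ s, s ∉ Icc 0 T → w s = 0) :
    ∫ s in (0 : ℝ)..L, φ s * w s = ∫ s in (0 : ℝ)..T, φ s * w s := by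
  rw [← intervalIntegral.integral_add_adjacent_intervals (hi 0 T) (hi T L), add_eq_left,
    intervalIntegral.integral_of_le hTL,
    setIntegral_congr_fun (g := fun _ => (0 : ℝ)) measurableSet_Ioc
      fun s hs => by simp [hw s fun h => hs.1.not_ge h.2]]
  simp

/-- A state is reachable in time `T` if and only if some control, read backwards in time, wraps
to the first component and has the first moment prescribed by the second one. -/
lemma mem_reachableSet_iff {T : ℝ} {K : ℕ} (hT0 : 0 ≤ T) (hT : T ≤ 2 * π * K) {F : LInf}
    {f : ℝ} :
    (F, f) ∈ reachableSet T ↔ ∃ w : ℝ → ℝ, Measurable w ∧ (∀ s, |w s| ≤ 1) ∧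
      (∀ s, s ∉ Icc 0 T → w s = 0) ∧ (F : Circ → ℝ) =ᵐ[volume] wrap K w ∧
      ∫ s in (0 : ℝ)..2 * π * K, s * w s = -(2 * π * f) := by
  have hpi := Real.two_pi_pos
  have hmom {u : ℝ → ℝ} (hu : Measurable u) (hb : ∀ s, |u s| ≤ 1)
      (h0 : ∀ s, s ∉ Icc 0 T → u s = 0) : ∫ s in (0 : ℝ)..2 * π * K, s * u (T - s) =
        ∫ s in (0 : ℝ)..T, u s * (T - s) := by
    rw [integral_eq_of_eq_zero_off (φ := fun s => s) (w := fun s => u (T - s)) hT]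
    · have h1 := intervalIntegral.integral_comp_sub_left (a := 0) (b := T)
        (fun s => u s * (T - s)) T
      simp only [sub_sub_cancel, sub_zero, sub_self] at h1
      rw [← h1]
      exact intervalIntegral.integral_congr fun s _ => mul_comm _ _
    · intro a b
      simpa only [mul_comm] using intervalIntegrable_mul_continuous
        (w := fun s => u (T - s)) (by fun_prop) (fun _ => hb _) continuous_id' a b
    · intro s hs
      refine h0 _ fun h => hs ⟨by linarith [h.2], by linarith [h.1]⟩
  constructor
  · rintro ⟨u₀, F₀, f₀, hu₀, htraj, rfl, rfl⟩
    -- A Borel version of the control, bounded everywhere and zero off [0, T], drives the same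
    -- trajectory.
    set u : ℝ → ℝ := (Icc 0 T).indicator fun s => max (-1) (min 1 (hu₀.1.mk u₀ s)) with hu_def
    have hu : Measurable u :=
      (measurable_const.max (measurable_const.min hu₀.1.measurable_mk)).indicator measurableSet_Icc
    have hb (s : ℝ) : |u s| ≤ 1 := by
      rw [hu_def, indicator]
      split_ifs
      · rw [abs_le]
        exact ⟨le_max_left _ _, max_le (by norm_num) (min_le_left _ _)⟩
      · simp
    have h0 (s : ℝ) (hs : s ∉ Icc 0 T) : u s = 0 := indicator_of_notMem hs _
    have huu : u₀ =ᵐ[volume.restrict (Icc 0 T)] u := by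
      filter_upwards [hu₀.1.ae_eq_mk, hu₀.2, ae_restrict_mem measurableSet_Icc] with s h1 h2 h3
      rw [abs_le] at h2
      rw [hu_def, indicator_of_mem h3, ← h1, min_eq_right h2.2, max_eq_right h2.1]
    have hadm : IsAdmissibleControl T u := ⟨hu.aemeasurable, .of_forall hb⟩
    obtain ⟨G, g, hG, hGw, hgT⟩ := exists_isTrajectory hT0 hT hu hb fun s hs =>
      h0 s fun h => hs.not_ge h.1
    have htraj' := htraj.congr_control huu
    have hTT : T ∈ Icc 0 T := ⟨hT0, le_rfl⟩
    refine ⟨fun s => u (T - s), by fun_prop, fun s => hb _, fun s hs => h0 _ fun h =>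
      hs ⟨by linarith [h.2], by linarith [h.1]⟩, ?_, ?_⟩
    · rw [htraj'.unique hadm hG hTT]
      exact hGw T
    · have hfg : f₀ T = g T := by
        rw [htraj.average T hTT, hG.average T hTT, htraj.f_init, hG.f_init]
        congr 1
        refine intervalIntegral.integral_congr fun s hs => ?_
        rw [uIcc_of_le hT0] at hs
        simp only [htraj'.unique hadm hG hs]
      rw [hmom hu hb h0, hfg, hgT]
      field_simp
  · rintro ⟨w, hw, hb, h0, hF, hf⟩
    have h0' (s : ℝ) (hs : s ∉ Icc 0 T) : w (T - s) = 0 :=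
      h0 _ fun h => hs ⟨by linarith [h.2], by linarith [h.1]⟩
    obtain ⟨G, g, hG, hGw, hgT⟩ := exists_isTrajectory (u := fun s => w (T - s)) hT0 hT
      (by fun_prop) (fun _ => hb _) fun s hs => h0' s fun h => hs.not_ge h.1
    refine ⟨_, G, g, ⟨by fun_prop, .of_forall fun _ => hb _⟩, hG, ?_, ?_⟩
    · refine Lp.ext ?_
      have := hGw T
      simp only [sub_sub_cancel] at this
      exact this.trans hF.symm
    · rw [hgT, ← hmom (u := fun s => w (T - s)) (by fun_prop) (fun _ => hb _) h0']
      simp only [sub_sub_cancel, hf]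
      field_simp

/-! ### Upper bound for the centred moment on one fibre -/

/-- The right side is the integral of the convex function 2|r| over [a - π, a + π], so this is
Jensen's inequality. It compares a sum over points spaced by 2π with an integral. -/
lemma abs_le_sub_mul_abs (a : ℝ) :
    4 * π * |a| ≤ (a + π) * |a + π| - (a - π) * |a - π| := by
  have hpi := Real.pi_pos
  rcases abs_cases a with ⟨h, h'⟩ | ⟨h, h'⟩ <;>
    rcases abs_cases (a + π) with ⟨h1, h1'⟩ | ⟨h1, h1'⟩ <;>
      rcases abs_cases (a - π) with ⟨h2, h2'⟩ | ⟨h2, h2'⟩ <;>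
        rw [h, h1, h2] <;> nlinarith [sq_nonneg (a - π), sq_nonneg (a + π)]

lemma sum_abs_le_telescope (y : ℝ) (K : ℕ) :
    4 * π * ∑ k ∈ Finset.range K, |y + 2 * π * k| ≤
      (y + 2 * π * K - π) * |y + 2 * π * K - π| - (y - π) * |y - π| := by
  induction K with
  | zero => simp
  | succ K ih =>
    rw [Finset.sum_range_succ, mul_add]
    have h := abs_le_sub_mul_abs (y + 2 * π * K)
    have h1 : y + 2 * π * ((K + 1 : ℕ) : ℝ) - π = y + 2 * π * K + π := by push_cast; ring
    rw [h1]
    linarith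

lemma mul_abs_self_le_sq (a : ℝ) : a * |a| ≤ a ^ 2 := by
  nlinarith [le_abs_self a, abs_nonneg a, abs_mul_abs_self a]

lemma neg_sq_le_mul_abs_self (a : ℝ) : -a ^ 2 ≤ a * |a| := by
  nlinarith [neg_abs_le a, abs_nonneg a, abs_mul_abs_self a]

lemma abs_sum_le_card {K : ℕ} {v : ℕ → ℝ} (hv : ∀ k, |v k| ≤ 1) :
    |∑ k ∈ Finset.range K, v k| ≤ K := by
  refine (Finset.abs_sum_le_sum_abs _ _).trans ?_
  simpa using Finset.sum_le_sum (s := Finset.range K) fun k _ => hv k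

/-- Adding the multiplier πF to the weights costs exactly πF² and leaves a problem without
constraint, whose maximum is a sum of absolute values. The value πF is natural: signs switching at
T/2 - πF on points of spacing 2π in [0, T] have total about F. -/
lemma fibre_moment_le {T x : ℝ} {K : ℕ} (hT : 0 ≤ T) (hK : T ≤ 2 * π * K)
    (hK' : 2 * π * K ≤ T + 2 * π) (hx : x ∈ Ioc 0 (2 * π)) {v : ℕ → ℝ} (hv : ∀ k, |v k| ≤ 1) :
    ∑ k ∈ Finset.range K, (x + 2 * π * k - T / 2) * v k ≤
      (T ^ 2 / 4 - π ^ 2 * (∑ k ∈ Finset.range K, v k) ^ 2) / (2 * π) + (2 * T + 5 * π) := by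
  have hpi := Real.pi_pos
  set F := ∑ k ∈ Finset.range K, v k with hF
  have hFK : |π * F| ≤ T / 2 + π := by
    rw [abs_mul, abs_of_pos hpi]
    nlinarith [abs_sum_le_card (K := K) hv]
  have h1 : ∑ k ∈ Finset.range K, (x + 2 * π * k - T / 2) * v k ≤
      ∑ k ∈ Finset.range K, |x - T / 2 + π * F + 2 * π * k| - π * F * F := by
    have : ∑ k ∈ Finset.range K, (x + 2 * π * k - T / 2) * v k =
        ∑ k ∈ Finset.range K, (x - T / 2 + π * F + 2 * π * k) * v k - π * F * F := by
      have : π * F * F = ∑ k ∈ Finset.range K, π * F * v k := by rw [← Finset.mul_sum]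
      rw [this, ← Finset.sum_sub_distrib]
      exact Finset.sum_congr rfl fun k _ => by ring
    rw [this]
    refine sub_le_sub_right (Finset.sum_le_sum fun k _ => ?_) _
    refine (le_abs_self _).trans ?_
    rw [abs_mul]
    exact mul_le_of_le_one_right (abs_nonneg _) (hv k)
  have h2 := sum_abs_le_telescope (x - T / 2 + π * F) K
  have h3 := mul_abs_self_le_sq (x - T / 2 + π * F + 2 * π * K - π)
  have h4 := neg_sq_le_mul_abs_self (x - T / 2 + π * F - π)
  obtain ⟨hF1, hF2⟩ := abs_le.1 hFK
  set c := π * F with hc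
  -- The telescoped end points differ from T/2 + c and -(T/2 - c) by e and x - π, both bounded;
  -- after squaring this costs O(T).
  obtain ⟨e, he⟩ : ∃ e, e = x + 2 * π * K - π - T := ⟨_, rfl⟩
  have he1 : -π ≤ e := by linarith [hx.1]
  have he2 : e ≤ 3 * π := by linarith [hx.2]
  have h5 : x - T / 2 + c + 2 * π * K - π = T / 2 + c + e := by rw [he]; ring
  rw [h5] at h2 h3
  have h6 : (T / 2 + c + e) ^ 2 ≤ (T / 2 + c) ^ 2 + 6 * π * (T + π) + 9 * π ^ 2 := by
    have : |T / 2 + c| * |e| ≤ (T + π) * (3 * π) := by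
      apply mul_le_mul _ _ (abs_nonneg _) (by linarith)
      · rw [abs_le]; constructor <;> linarith
      · rw [abs_le]; constructor <;> linarith
    rw [← abs_mul] at this
    have h7 := le_abs_self ((T / 2 + c) * e)
    nlinarith
  have h8 : (x - T / 2 + c - π) ^ 2 ≤ (T / 2 - c) ^ 2 + 2 * π * (T + π) + π ^ 2 := by
    have : |T / 2 - c| * |x - π| ≤ (T + π) * π := by
      apply mul_le_mul _ _ (abs_nonneg _) (by linarith)
      · rw [abs_le]; constructor <;> linarith
      · rw [abs_le]; constructor <;> linarith [hx.1, hx.2]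
    rw [← abs_mul] at this
    have h7 := neg_abs_le ((T / 2 - c) * (x - π))
    nlinarith [hx.1, hx.2]
  have h9 : π ^ 2 * F ^ 2 = c ^ 2 := by rw [hc]; ring
  have h10 : c * F = c ^ 2 / π := by rw [hc]; field_simp
  refine h1.trans ?_
  rw [h9, h10]
  have h11 : ∑ k ∈ Finset.range K, |x - T / 2 + c + 2 * π * k| ≤
      ((T / 2 + c) ^ 2 + (T / 2 - c) ^ 2 + 8 * π * (T + π) + 10 * π ^ 2) / (4 * π) := by
    rw [le_div_iff₀ (by positivity)]
    linarith
  refine (sub_le_sub_right h11 _).trans ?_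
  rw [← sub_nonneg]
  have : (T ^ 2 / 4 - c ^ 2) / (2 * π) + (2 * T + 5 * π) -
      (((T / 2 + c) ^ 2 + (T / 2 - c) ^ 2 + 8 * π * (T + π) + 10 * π ^ 2) / (4 * π) -
        c ^ 2 / π) = π / 2 := by
    field_simp
    ring
  rw [this]
  positivity

lemma abs_fibre_moment_le {T x : ℝ} {K : ℕ} (hT : 0 ≤ T) (hK : T ≤ 2 * π * K)
    (hK' : 2 * π * K ≤ T + 2 * π) (hx : x ∈ Ioc 0 (2 * π)) {v : ℕ → ℝ} (hv : ∀ k, |v k| ≤ 1) :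
    |∑ k ∈ Finset.range K, (x + 2 * π * k - T / 2) * v k| ≤
      (T ^ 2 / 4 - π ^ 2 * (∑ k ∈ Finset.range K, v k) ^ 2) / (2 * π) + (2 * T + 5 * π) := by
  rw [abs_le']
  refine ⟨fibre_moment_le hT hK hK' hx hv, ?_⟩
  have := fibre_moment_le hT hK hK' hx (v := fun k => -v k) fun k => by simpa using hv k
  simpa [Finset.sum_neg_distrib] using this

/-! ### Extremal weights on one fibre -/

/-- Bang-bang weights on the points `0, …, N - 1` with total `y`: `1` on the first points and `-1`
on the last ones, with at most one intermediate value. -/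
def profile (N : ℕ) (y r : ℝ) : ℝ := 2 * max 0 (min 1 ((N + y) / 2 - r)) - 1

lemma abs_profile_le (N : ℕ) (y r : ℝ) : |profile N y r| ≤ 1 := by
  have h1 : 0 ≤ max 0 (min 1 ((N + y) / 2 - r)) := le_max_left _ _
  have h2 : max 0 (min 1 ((N + y) / 2 - r)) ≤ 1 := max_le zero_le_one (min_le_left _ _)
  rw [profile, abs_le]
  constructor <;> linarith

/-- The clamped weights fill the first points up to total mass p. With θ the fractional part of p,
the second sum is p² - p + θ(1 - θ), whence the 1/4. -/
lemma sum_clamp (n : ℕ) {p : ℝ} (h0 : 0 ≤ p) (hp : p ≤ n) :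
    ∑ j ∈ Finset.range n, max 0 (min 1 (p - j)) = p ∧
      ∑ j ∈ Finset.range n, 2 * (j : ℝ) * max 0 (min 1 (p - j)) ≤ p ^ 2 - p + 1 / 4 := by
  induction n with
  | zero =>
    have : p = 0 := le_antisymm (by simpa using hp) h0
    simp [this]
  | succ n ih =>
    rw [Finset.sum_range_succ, Finset.sum_range_succ]
    push_cast at hp
    rcases le_total p n with h | h
    · have h1 : max 0 (min 1 (p - n)) = 0 :=
        max_eq_left ((min_le_right _ _).trans (by linarith))
      simpa [h1] using ih h
    · have h1 : max 0 (min 1 (p - n)) = p - n := by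
        rw [min_eq_right (by linarith), max_eq_right (by linarith)]
      have h2 {j : ℕ} (hj : j ∈ Finset.range n) : max 0 (min 1 (p - j)) = 1 := by
        have : ((j + 1 : ℕ) : ℝ) ≤ n := by exact_mod_cast Finset.mem_range.1 hj
        push_cast at this
        rw [min_eq_left (by linarith), max_eq_right zero_le_one]
      have h3 : 2 * ∑ j ∈ Finset.range n, (j : ℝ) = n * (n - 1) := by
        clear * -
        induction n with
        | zero => simp
        | succ n ih => rw [Finset.sum_range_succ, mul_add, ih]; push_cast; ring
      have h4 : ∑ j ∈ Finset.range n, 2 * (j : ℝ) * max 0 (min 1 (p - j)) = n * (n - 1) := by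
        rw [← h3, Finset.mul_sum]
        exact Finset.sum_congr rfl fun j hj => by rw [h2 hj, mul_one]
      rw [h1, h4, Finset.sum_congr rfl fun j hj => h2 hj]
      refine ⟨by simp, ?_⟩
      nlinarith [sq_nonneg (p - n - 1 / 2)]

lemma sum_profile {N : ℕ} {y : ℝ} (hy : |y| ≤ N) :
    ∑ k ∈ Finset.range N, profile N y k = y := by
  obtain ⟨h1, h2⟩ := abs_le.1 hy
  have h := (sum_clamp N (p := (N + y) / 2) (by linarith) (by linarith)).1
  unfold profile
  rw [Finset.sum_sub_distrib, ← Finset.mul_sum, h]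
  simp
  ring

lemma cast_reflect {N k : ℕ} (hk : k ∈ Finset.range N) :
    ((N - 1 - k : ℕ) : ℝ) = (N : ℝ) - 1 - k := by
  have : k + 1 ≤ N := Finset.mem_range.1 hk
  rw [Nat.sub_sub, add_comm 1 k, Nat.cast_sub this]
  push_cast
  ring

lemma sum_centred (N : ℕ) : ∑ k ∈ Finset.range N, ((N : ℝ) - 1 - 2 * k) = 0 := by
  have h := Finset.sum_range_reflect (fun k : ℕ => ((N : ℝ) - 1 - 2 * k)) N
  have h' : ∑ k ∈ Finset.range N, ((N : ℝ) - 1 - 2 * ((N - 1 - k : ℕ) : ℝ)) =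
      -∑ k ∈ Finset.range N, ((N : ℝ) - 1 - 2 * k) := by
    rw [← Finset.sum_neg_distrib]
    refine Finset.sum_congr rfl fun k hk => ?_
    rw [cast_reflect hk]
    ring
  linarith

/-- With p = (N + y)/2 filled points the main term is 2p(N - p) = (N² - y²)/2. Up to a constant,
this matches the bound of `fibre_moment_le`. -/
lemma le_sum_centred_mul_profile {N : ℕ} {y : ℝ} (hy : |y| ≤ N) :
    ((N : ℝ) ^ 2 - y ^ 2) / 2 - 1 / 2 ≤
      ∑ k ∈ Finset.range N, ((N : ℝ) - 1 - 2 * k) * profile N y k := by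
  obtain ⟨h1, h2⟩ := abs_le.1 hy
  obtain ⟨h3, h4⟩ := sum_clamp N (p := (N + y) / 2) (by linarith) (by linarith)
  have : ∑ k ∈ Finset.range N, ((N : ℝ) - 1 - 2 * k) * profile N y k =
      2 * ((N : ℝ) - 1) * ∑ j ∈ Finset.range N, max 0 (min 1 ((N + y) / 2 - j)) -
      2 * ∑ j ∈ Finset.range N, 2 * (j : ℝ) * max 0 (min 1 ((N + y) / 2 - j)) -
      ∑ k ∈ Finset.range N, ((N : ℝ) - 1 - 2 * k) := by
    rw [Finset.mul_sum, Finset.mul_sum, ← Finset.sum_sub_distrib, ← Finset.sum_sub_distrib]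
    exact Finset.sum_congr rfl fun k _ => by unfold profile; ring
  rw [this, h3, sum_centred]
  nlinarith

lemma sum_profile_reflect {N : ℕ} {y : ℝ} (hy : |y| ≤ N) :
    ∑ k ∈ Finset.range N, profile N y (N - 1 - k) = y := by
  conv_rhs => rw [← sum_profile hy, ← Finset.sum_range_reflect]
  exact Finset.sum_congr rfl fun k hk => by rw [cast_reflect hk]

lemma sum_centred_mul_profile_reflect (N : ℕ) (y : ℝ) :
    ∑ k ∈ Finset.range N, ((N : ℝ) - 1 - 2 * k) * profile N y (N - 1 - k) =
      -∑ k ∈ Finset.range N, ((N : ℝ) - 1 - 2 * k) * profile N y k := by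
  rw [← Finset.sum_range_reflect (fun k : ℕ => ((N : ℝ) - 1 - 2 * k) * profile N y k),
    ← Finset.sum_neg_distrib]
  refine Finset.sum_congr rfl fun k hk => ?_
  rw [cast_reflect hk]
  ring

/-! ### Necessary conditions for reachability -/

lemma LInf.ae_abs_le (F : LInf) : ∀ᵐ z, |F z| ≤ ‖F‖ := by
  have h := ae_le_lpNorm_exponent_top (Lp.memLp F)
  rw [← toReal_eLpNorm (Lp.aestronglyMeasurable F), ← Lp.norm_def] at h
  exact h

lemma LInf.ae_restrict_abs_le (F : LInf) :
    ∀ᵐ x : ℝ ∂volume.restrict (Ioc 0 (2 * π)), |F (x : Circ)| ≤ ‖F‖ :=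
  ae_restrict_Ioc_of_ae_circ F.ae_abs_le

lemma LInf.norm_le_of_ae {F : LInf} {C : ℝ} (hC : 0 ≤ C) (h : ∀ᵐ z, |F z| ≤ C) : ‖F‖ ≤ C := by
  have := Lp.norm_le_of_ae_bound (f := F) hC h
  simpa using this

lemma integral_eq_two_pi_mul_circMean (G : Circ → ℝ) :
    ∫ x in (0 : ℝ)..2 * π, G (x : Circ) = 2 * π * circMean G := by
  rw [circMean_eq_intervalIntegral]
  field_simp

lemma intervalIntegral_mono_circ {g h : ℝ → ℝ} (hg : IntervalIntegrable g volume 0 (2 * π))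
    (hh : IntervalIntegrable h volume 0 (2 * π))
    (hgh : ∀ᵐ x ∂volume.restrict (Ioc 0 (2 * π)), g x ≤ h x) :
    ∫ x in (0 : ℝ)..2 * π, g x ≤ ∫ x in (0 : ℝ)..2 * π, h x := by
  have hpi := Real.two_pi_pos.le
  rw [intervalIntegral.integral_of_le hpi, intervalIntegral.integral_of_le hpi]
  rw [intervalIntegrable_iff, uIoc_of_le hpi] at hg hh
  exact integral_mono_ae hg hh hgh

lemma LInf.intervalIntegrable_sq (F : LInf) :
    IntervalIntegrable (fun x : ℝ => F (x : Circ) ^ 2) volume 0 (2 * π) := by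
  rw [intervalIntegrable_iff, uIoc_of_le Real.two_pi_pos.le]
  refine Measure.integrableOn_of_bounded (M := ‖F‖ ^ 2) measure_Ioc_lt_top.ne ?_ ?_
  · exact (((Lp.stronglyMeasurable F).measurable.comp AddCircle.measurable_mk').pow_const
      2).aestronglyMeasurable
  · filter_upwards [F.ae_restrict_abs_le] with x hx
    rw [norm_pow, Real.norm_eq_abs]
    exact pow_le_pow_left₀ (abs_nonneg _) hx 2

/-- Necessary conditions for a state to be reachable in time `T`. -/
lemma bounds_of_mem_reachableSet {T : ℝ} (hT : 0 ≤ T) {F : LInf} {f : ℝ}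
    (h : (F, f) ∈ reachableSet T) :
    2 * π * ‖F‖ ≤ T + 2 * π ∧ 2 * π * |circMean F| ≤ T ∧
      π * |2 * f + T * circMean F| ≤
        T ^ 2 / 4 - π ^ 2 * circMean (fun z => F z ^ 2) + 4 * π * T + 10 * π ^ 2 := by
  have hpi := Real.pi_pos
  -- The least number of turns covering [0, T]; the bounds on the norm and on the fibre moments need
  -- 2πK ≤ T + 2π.
  set K := ⌈T / (2 * π)⌉₊ with hK_def
  have hK : T ≤ 2 * π * K := by
    have := Nat.le_ceil (T / (2 * π))
    rwa [div_le_iff₀' (by positivity)] at this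
  have hK' : 2 * π * K ≤ T + 2 * π := by
    have := (Nat.ceil_lt_add_one (a := T / (2 * π)) (by positivity)).le
    calc 2 * π * K ≤ 2 * π * (T / (2 * π) + 1) := by gcongr
      _ = T + 2 * π := by field_simp
  obtain ⟨w, hw, hb, h0, hF, hf⟩ := (mem_reachableSet_iff hT hK).1 h
  have hF' := ae_eq_fibreSum_of_ae_eq_wrap hF
  have hwi (a b : ℝ) : IntervalIntegrable w volume a b := intervalIntegrable_of_bound hw hb a b
  have hmi (φ : ℝ → ℝ) (hφ : Continuous φ) (a b : ℝ) :
      IntervalIntegrable (fun s => φ s * w s) volume a b := by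
    simpa only [mul_comm] using intervalIntegrable_mul_continuous hw hb hφ a b
  have hmass : ∫ s in (0 : ℝ)..2 * π * K, w s = 2 * π * circMean F := by
    rw [integral_fibreSum hwi, ← integral_eq_two_pi_mul_circMean]
    exact (intervalIntegral_congr_circ hF').symm
  refine ⟨?_, ?_, ?_⟩
  · have : ‖F‖ ≤ K := LInf.norm_le_of_ae (Nat.cast_nonneg _) (by
      filter_upwards [hF] with z hz
      rw [hz]
      exact abs_fibreSum_le hb _)
    exact (mul_le_mul_of_nonneg_left this (by positivity)).trans hK'
  · have h1 := integral_eq_of_eq_zero_off (φ := fun _ => 1) hK (hmi _ continuous_const) h0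
    simp only [one_mul] at h1
    rw [h1] at hmass
    have h2 : ‖∫ s in (0 : ℝ)..T, w s‖ ≤ 1 * |T - 0| :=
      intervalIntegral.norm_integral_le_of_norm_le_const fun x _ => hb x
    rw [hmass, Real.norm_eq_abs, abs_mul, abs_of_pos (by positivity : 0 < 2 * π), sub_zero,
      abs_of_nonneg hT, one_mul] at h2
    exact h2
  · have h1 : ∫ s in (0 : ℝ)..2 * π * K, (s - T / 2) * w s =
        -(π * (2 * f + T * circMean F)) := by
      have : ∀ s, (s - T / 2) * w s = s * w s - T / 2 * w s := fun s => by ring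
      simp only [this]
      rw [intervalIntegral.integral_sub (hmi _ continuous_id' _ _) ((hwi _ _).const_mul _), hf,
        intervalIntegral.integral_const_mul, hmass]
      ring
    rw [integral_fibreSum (hmi _ (by fun_prop))] at h1
    have h2 : |∫ x in (0 : ℝ)..2 * π, fibreSum K (fun s => (s - T / 2) * w s) x| ≤
        ∫ x in (0 : ℝ)..2 * π, ((T ^ 2 / 4 + 4 * π * T + 10 * π ^ 2) / (2 * π) -
          π / 2 * F (x : Circ) ^ 2) := by
      rw [← Real.norm_eq_abs]
      refine intervalIntegral.norm_integral_le_of_norm_le (by positivity) ?_ ?_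
      · rw [← ae_restrict_iff' measurableSet_Ioc]
        filter_upwards [hF', ae_restrict_mem measurableSet_Ioc] with x hx hx'
        have h3 := abs_fibre_moment_le hT hK hK' hx' (v := fun k => w (x + 2 * π * k))
          fun _ => hb _
        rw [hx]
        refine h3.trans (le_of_eq ?_)
        simp only [fibreSum]
        field_simp
        ring
      · exact intervalIntegrable_const.sub (F.intervalIntegrable_sq.const_mul _)
    rw [h1, abs_neg, abs_mul, abs_of_pos hpi, intervalIntegral.integral_sub
      intervalIntegrable_const (F.intervalIntegrable_sq.const_mul _),
      intervalIntegral.integral_const, intervalIntegral.integral_const_mul,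
      integral_eq_two_pi_mul_circMean (fun z => F z ^ 2)] at h2
    refine h2.trans (le_of_eq ?_)
    simp only [sub_zero, smul_eq_mul]
    field_simp
    ring

/-! ### Sufficient condition over full turns -/

/-- Since x - π has mean zero, F may be replaced by F - σ‖F‖, which has constant sign for σ = ±1, so
its L¹ norm is explicit. The factor ‖F‖ - |⟨F⟩| matters: the slack available in `bound_after_root`
degenerates in the same way. -/
lemma abs_integral_sub_pi_mul_le (F : LInf) :
    |∫ x in (0 : ℝ)..2 * π, (x - π) * F (x : Circ)| ≤ 2 * π ^ 2 * (‖F‖ - |circMean F|) := by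
  have hpi := Real.pi_pos
  have h0 : ∫ x in (0 : ℝ)..2 * π, (x - π) = 0 := by
    rw [intervalIntegral.integral_sub intervalIntegral.intervalIntegrable_id
      intervalIntegrable_const, integral_id, intervalIntegral.integral_const]
    simp; ring
  have hFi := F.intervalIntegrable
  have key (σ : ℝ) (hσ : σ = 1 ∨ σ = -1) : |∫ x in (0 : ℝ)..2 * π, (x - π) * F (x : Circ)| ≤
      2 * π ^ 2 * (‖F‖ - σ * circMean F) := by
    have h1 : ∫ x in (0 : ℝ)..2 * π, (x - π) * F (x : Circ) =
        ∫ x in (0 : ℝ)..2 * π, (x - π) * (F (x : Circ) - σ * ‖F‖) := by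
      simp only [mul_sub]
      rw [intervalIntegral.integral_sub (hFi.continuousOn_mul (by fun_prop))
        (Continuous.intervalIntegrable (by fun_prop) _ _), intervalIntegral.integral_mul_const, h0]
      simp
    have h2 : |∫ x in (0 : ℝ)..2 * π, (x - π) * (F (x : Circ) - σ * ‖F‖)| ≤
        ∫ x in (0 : ℝ)..2 * π, π * (‖F‖ - σ * F (x : Circ)) := by
      rw [← Real.norm_eq_abs]
      refine intervalIntegral.norm_integral_le_of_norm_le (by positivity) ?_
        ((intervalIntegrable_const.sub (hFi.const_mul _)).const_mul _)
      rw [← ae_restrict_iff' measurableSet_Ioc]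
      filter_upwards [F.ae_restrict_abs_le, ae_restrict_mem measurableSet_Ioc] with x hx hx'
      obtain ⟨h3, h4⟩ := abs_le.1 hx
      rw [norm_mul, Real.norm_eq_abs, Real.norm_eq_abs]
      refine mul_le_mul ?_ ?_ (abs_nonneg _) hpi.le
      · rw [abs_le]; constructor <;> linarith [hx'.1, hx'.2]
      · rcases hσ with rfl | rfl <;> rw [abs_le] <;> constructor <;> linarith
    rw [h1]
    refine h2.trans (le_of_eq ?_)
    rw [intervalIntegral.integral_const_mul, intervalIntegral.integral_sub
      intervalIntegrable_const (hFi.const_mul _), intervalIntegral.integral_const,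
      intervalIntegral.integral_const_mul, integral_eq_two_pi_mul_circMean]
    simp only [sub_zero, smul_eq_mul]
    ring
  rcases abs_cases (circMean F) with ⟨h, _⟩ | ⟨h, _⟩
  · simpa [h] using key 1 (.inl rfl)
  · simpa [h] using key (-1) (.inr rfl)

lemma coe_circRep (z : Circ) : (circRep z : Circ) = z :=
  (AddCircle.equivIoc (2 * π) 0).symm_apply_apply z

lemma measurable_profile {N : ℕ} {g r : ℝ → ℝ} (hg : Measurable g) (hr : Measurable r) :
    Measurable fun s => profile N (g s) (r s) := by
  unfold profile
  fun_prop

lemma ceil_fibre {x : ℝ} (hx : x ∈ Ioc 0 (2 * π)) (k : ℕ) :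
    ((⌈(x + 2 * π * k) / (2 * π)⌉ : ℤ) : ℝ) - 1 = k := by
  have hpi := Real.two_pi_pos
  have : ⌈(x + 2 * π * k) / (2 * π)⌉ = (k : ℤ) + 1 := by
    rw [Int.ceil_eq_iff, lt_div_iff₀ hpi, div_le_iff₀ hpi]
    push_cast
    constructor <;> linarith [hx.1, hx.2]
  rw [this]
  push_cast
  ring

/-- A sufficient condition for a state to be reachable in `N` turns around the circle. -/
lemma mem_reachableSet_of_le {N : ℕ} {F : LInf} {f : ℝ} (hN : ‖F‖ ≤ N)
    (h : π * |2 * f + 2 * π * N * circMean F| + 2 * π ^ 2 * (‖F‖ - |circMean F|) + π ^ 2 ≤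
      π ^ 2 * N ^ 2 - π ^ 2 * circMean (fun z => F z ^ 2)) :
    (F, f) ∈ reachableSet (2 * π * N) := by
  have hpi := Real.pi_pos
  -- F is bounded only almost everywhere, whereas the profiles need |y| ≤ N at every point.
  set g : ℝ → ℝ := fun x => max (-N) (min N (F (x : Circ))) with hg_def
  have hFm : Measurable fun x : ℝ => F (x : Circ) :=
    (Lp.stronglyMeasurable F).measurable.comp AddCircle.measurable_mk'
  have hg : Measurable g := measurable_const.max (measurable_const.min hFm)
  have hgN (x : ℝ) : |g x| ≤ N := by
    rw [abs_le]
    have : (0 : ℝ) ≤ N := Nat.cast_nonneg N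
    exact ⟨le_max_left _ _, max_le (by linarith) (min_le_left _ _)⟩
  have hgF {x : ℝ} (hx : |F (x : Circ)| ≤ ‖F‖) : g x = F (x : Circ) := by
    obtain ⟨h1, h2⟩ := abs_le.1 hx
    rw [hg_def]
    simp only
    rw [min_eq_right (h2.trans hN), max_eq_right (by linarith)]
  have hgFae : ∀ᵐ x : ℝ ∂volume.restrict (Ioc 0 (2 * π)), g x = F (x : Circ) := by
    filter_upwards [F.ae_restrict_abs_le] with x hx using hgF hx
  have hgper (x : ℝ) (k : ℕ) : g (x + 2 * π * k) = g x := by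
    have : ((x + 2 * π * k : ℝ) : Circ) = (x : Circ) := by
      have h2 := AddCircle.coe_add_period (2 * π)
      have h3 : Function.Periodic (fun y : ℝ => (y : Circ)) (2 * π) := h2
      have := h3.nat_mul k x
      rwa [mul_comm (k : ℝ)] at this
    simp only [hg_def, this]
  set B : ℝ → ℝ := fun x => ∑ k ∈ Finset.range N, ((N : ℝ) - 1 - 2 * k) * profile N (g x) k
    with hB_def
  have hBi : IntervalIntegrable B volume 0 (2 * π) := by
    refine intervalIntegrable_of_bound (C := ∑ k ∈ Finset.range N, |(N : ℝ) - 1 - 2 * k|)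
      (Finset.measurable_sum _ fun k _ => (measurable_profile hg measurable_const).const_mul _)
      (fun s => (Finset.abs_sum_le_sum_abs _ _).trans (Finset.sum_le_sum fun k _ => ?_)) _ _
    rw [abs_mul]
    exact mul_le_of_le_one_right (abs_nonneg _) (abs_profile_le _ _ _)
  set I : ℝ := ∫ x in (0 : ℝ)..2 * π, B x with hI
  set R : ℝ := ∫ x in (0 : ℝ)..2 * π, (x - π) * F (x : Circ) with hR
  have hIle : π * N ^ 2 - π * circMean (fun z => F z ^ 2) - π ≤ I := by
    have h1 : ∫ x in (0 : ℝ)..2 * π, (((N : ℝ) ^ 2 / 2 - 1 / 2) - 1 / 2 * F (x : Circ) ^ 2) ≤ I := by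
      refine intervalIntegral_mono_circ
        (intervalIntegrable_const.sub (F.intervalIntegrable_sq.const_mul _)) hBi ?_
      filter_upwards [hgFae] with x hx
      have := le_sum_centred_mul_profile (hgN x)
      rw [← hx]
      linarith
    rw [intervalIntegral.integral_sub intervalIntegrable_const
      (F.intervalIntegrable_sq.const_mul _), intervalIntegral.integral_const,
      intervalIntegral.integral_const_mul,
      integral_eq_two_pi_mul_circMean (fun z => F z ^ 2)] at h1
    simp only [sub_zero, smul_eq_mul] at h1
    linarith
  have hRle := abs_integral_sub_pi_mul_le F
  rw [← hR] at hRle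
  -- The moment left for the profiles to supply, once the fibre sums have fixed the rest; they can
  -- supply any value in [-πI, πI].
  set X : ℝ := -(π * (2 * f + 2 * π * N * circMean F)) - R with hX
  have hXle : |X| ≤ π * I := by
    have h1 : |X| ≤ |π * (2 * f + 2 * π * N * circMean F)| + |R| := by
      rw [hX, ← abs_neg (π * _)]
      exact abs_sub _ _
    rw [abs_mul, abs_of_pos hpi] at h1
    nlinarith
  obtain ⟨μ, hμ, hμX⟩ : ∃ μ : ℝ, |μ| ≤ 1 ∧ μ * (π * I) = X := by
    rcases (abs_nonneg X).trans hXle |>.eq_or_lt with h0 | h0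
    · refine ⟨0, by simp, ?_⟩
      rw [zero_mul, eq_comm, ← abs_nonpos_iff, h0]
      exact hXle
    · refine ⟨X / (π * I), ?_, div_mul_cancel₀ _ h0.ne'⟩
      rw [abs_div, abs_of_pos h0]
      exact (div_le_one h0).2 hXle
  obtain ⟨hμ1, hμ2⟩ := abs_le.1 hμ
  -- The index of the turn containing s, for turns of the form (2πk, 2π(k + 1)].
  set r : ℝ → ℝ := fun s => ((⌈s / (2 * π)⌉ : ℤ) : ℝ) - 1 with hr_def
  have hr : Measurable r := by
    have : Measurable fun s : ℝ => ⌈s / (2 * π)⌉ := Int.measurable_ceil.comp (by fun_prop)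
    exact ((measurable_of_countable (fun n : ℤ => (n : ℝ))).comp this).sub_const 1
  -- Both profiles have fibre sum g and opposite centred moments, so this convex combination keeps
  -- the fibre sums and scales the moment by μ.
  set v : ℝ → ℝ := fun s => (1 - μ) / 2 * profile N (g s) (r s) +
    (1 + μ) / 2 * profile N (g s) (N - 1 - r s) with hv_def
  have hv : Measurable v := ((measurable_profile hg hr).const_mul _).add
    ((measurable_profile hg (hr.const_sub _)).const_mul _)
  have hvb (s : ℝ) : |v s| ≤ 1 := by
    obtain ⟨h1, h2⟩ := abs_le.1 (abs_profile_le N (g s) (r s))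
    obtain ⟨h3, h4⟩ := abs_le.1 (abs_profile_le N (g s) (N - 1 - r s))
    rw [abs_le, hv_def]
    constructor <;> nlinarith
  set w : ℝ → ℝ := (Ioc 0 (2 * π * N)).indicator v with hw_def
  have hw : Measurable w := hv.indicator measurableSet_Ioc
  have hwb (s : ℝ) : |w s| ≤ 1 := by
    rw [hw_def, indicator]
    split_ifs
    · exact hvb s
    · simp
  have hwx {x : ℝ} (hx : x ∈ Ioc 0 (2 * π)) {k : ℕ} (hk : k ∈ Finset.range N) :
      w (x + 2 * π * k) = (1 - μ) / 2 * profile N (g x) k +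
        (1 + μ) / 2 * profile N (g x) (N - 1 - k) := by
    have h1 : ((k + 1 : ℕ) : ℝ) ≤ N := by exact_mod_cast Finset.mem_range.1 hk
    push_cast at h1
    have h2 : x + 2 * π * k ∈ Ioc 0 (2 * π * N) :=
      ⟨by have := hx.1; positivity, by nlinarith [hx.2]⟩
    rw [hw_def, indicator_of_mem h2, hv_def]
    simp only [hgper, hr_def, ceil_fibre hx]
  have hsum {x : ℝ} (hx : x ∈ Ioc 0 (2 * π)) : fibreSum N w x = g x := by
    rw [fibreSum, Finset.sum_congr rfl fun k hk => hwx hx hk, Finset.sum_add_distrib,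
      ← Finset.mul_sum, ← Finset.mul_sum, sum_profile (hgN x), sum_profile_reflect (hgN x)]
    ring
  refine (mem_reachableSet_iff (by positivity) le_rfl).2 ⟨w, hw, hwb, fun s hs =>
    indicator_of_notMem (fun h => hs (Ioc_subset_Icc_self h)) _, ?_, ?_⟩
  · filter_upwards [F.ae_abs_le] with z hz
    rw [wrap, hsum (circRep_mem z), hgF (by rwa [coe_circRep]), coe_circRep]
  · have hmom {x : ℝ} (hx : x ∈ Ioc 0 (2 * π)) : fibreSum N (fun s => s * w s) x =
        μ * π * B x + ((x - π) * g x + π * N * g x) := by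
      have h1 : ∑ k ∈ Finset.range N, ((N : ℝ) - 1 - 2 * k) * w (x + 2 * π * k) = -(μ * B x) := by
        rw [Finset.sum_congr rfl fun k hk => by rw [hwx hx hk, mul_add, mul_left_comm,
          mul_left_comm (_ - _) ((1 + μ) / 2)], Finset.sum_add_distrib, ← Finset.mul_sum,
          ← Finset.mul_sum, sum_centred_mul_profile_reflect]
        ring
      have h2 := hsum hx
      rw [fibreSum] at h2
      have h3 : fibreSum N (fun s => s * w s) x =
          (x + π * (N - 1)) * ∑ k ∈ Finset.range N, w (x + 2 * π * k) -
            π * ∑ k ∈ Finset.range N, ((N : ℝ) - 1 - 2 * k) * w (x + 2 * π * k) := by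
        rw [Finset.mul_sum, Finset.mul_sum, ← Finset.sum_sub_distrib, fibreSum]
        exact Finset.sum_congr rfl fun k _ => by ring
      rw [h3, h1, h2]
      ring
    have hmi (a b : ℝ) : IntervalIntegrable (fun s => s * w s) volume a b := by
      simpa only [mul_comm] using intervalIntegrable_mul_continuous hw hwb continuous_id' a b
    have hFi := F.intervalIntegrable
    have hFi' : IntervalIntegrable (fun x : ℝ => (x - π) * F (x : Circ)) volume 0 (2 * π) :=
      hFi.continuousOn_mul (by fun_prop)
    rw [integral_fibreSum hmi, intervalIntegral_congr_circ
      (h := fun x => μ * π * B x + ((x - π) * F (x : Circ) + π * N * F (x : Circ))),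
      intervalIntegral.integral_add (hBi.const_mul _) (hFi'.add (hFi.const_mul _)),
      intervalIntegral.integral_add hFi' (hFi.const_mul _), intervalIntegral.integral_const_mul,
      intervalIntegral.integral_const_mul, integral_eq_two_pi_mul_circMean, ← hR, ← hI]
    · rw [mul_assoc, hμX, hX]
      ring
    · filter_upwards [hgFae, ae_restrict_mem measurableSet_Ioc] with x h1 h2
      rw [hmom h2, h1]

/-! ### The equation for T₁ and its stability -/

lemma abs_circMean_le (F : LInf) : |circMean F| ≤ ‖F‖ := by
  have hpi := Real.pi_pos
  have h := abs_integral_sub_pi_mul_le F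
  have h' := (abs_nonneg _).trans h
  have : 0 ≤ ‖F‖ - |circMean F| := nonneg_of_mul_nonneg_right h' (by positivity)
  linarith

lemma circMean_sq_le (F : LInf) : circMean F ^ 2 ≤ circMean fun z => F z ^ 2 := by
  have hpi := Real.pi_pos
  set m := circMean F with hm
  have hF := F.intervalIntegrable
  have hF2 := F.intervalIntegrable_sq
  have h : 0 ≤ ∫ x in (0 : ℝ)..2 * π, (F (x : Circ) - m) ^ 2 :=
    intervalIntegral.integral_nonneg (by positivity) fun x _ => sq_nonneg _
  have h1 (x : ℝ) : (F (x : Circ) - m) ^ 2 = F (x : Circ) ^ 2 - 2 * m * F (x : Circ) + m ^ 2 := by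
    ring
  simp only [h1] at h
  rw [intervalIntegral.integral_add (hF2.sub (hF.const_mul _)) intervalIntegrable_const,
    intervalIntegral.integral_sub hF2 (hF.const_mul _), intervalIntegral.integral_const_mul,
    intervalIntegral.integral_const, integral_eq_two_pi_mul_circMean,
    integral_eq_two_pi_mul_circMean (fun z => F z ^ 2), ← hm, smul_eq_mul] at h
  nlinarith

lemma norm_eq_zero_of_circMean_sq_eq_zero {F : LInf} (h : circMean (fun z => F z ^ 2) = 0) :
    ‖F‖ = 0 := by
  rw [circMean, mul_eq_zero, inv_eq_zero, or_iff_right Real.two_pi_pos.ne',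
    integral_eq_zero_iff_of_nonneg (fun _ => sq_nonneg _)
      ((Lp.memLp F).mono_exponent le_top).integrable_sq] at h
  refine le_antisymm (LInf.norm_le_of_ae le_rfl ?_) (norm_nonneg _)
  filter_upwards [h] with z hz
  have : F z = 0 := by simpa using hz
  simp [this]

lemma two_pi_mul_abs_le_of_root {m q f t : ℝ} (hmq : m ^ 2 ≤ q) (ht0 : 0 < t)
    (ht : 2 * |2 * f + t * m| = t ^ 2 / (2 * π) - 2 * π * q) : 2 * π * |m| ≤ t := by
  have hpi := Real.pi_pos
  have h1 : 0 ≤ t ^ 2 / (2 * π) - 2 * π * q := by rw [← ht]; positivity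
  have h2 : t ^ 2 = 2 * π * (t ^ 2 / (2 * π)) := by field_simp
  have h3 : (2 * π * |m|) ^ 2 ≤ t ^ 2 := by
    rw [h2, mul_pow, sq_abs]
    nlinarith [mul_le_mul_of_nonneg_left hmq (sq_nonneg (2 * π))]
  exact (le_abs_self _).trans (abs_le_of_sq_le_sq h3 ht0.le)

lemma abs_add_mul_le (f m s t : ℝ) : |2 * f + t * m| ≤ |2 * f + s * m| + |t - s| * |m| := by
  have h : 2 * f + t * m = (2 * f + s * m) + (t - s) * m := by ring
  rw [h, ← abs_mul]
  exact abs_add_le _ _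

/-- By `two_pi_mul_abs_le_of_root`, beyond a root the parabola grows strictly faster than 2|m|, the
largest slope of the left side. -/
lemma root_unique {m q f s t : ℝ} (hmq : m ^ 2 ≤ q) (hs0 : 0 < s)
    (hs : 2 * |2 * f + s * m| = s ^ 2 / (2 * π) - 2 * π * q)
    (ht : 2 * |2 * f + t * m| = t ^ 2 / (2 * π) - 2 * π * q) : t ≤ s := by
  by_contra! hst
  have hpi := Real.pi_pos
  have h1 := two_pi_mul_abs_le_of_root hmq hs0 hs
  have h2 := abs_add_mul_le f m s t
  rw [abs_of_pos (sub_pos.2 hst)] at h2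
  have h3 : t ^ 2 / (2 * π) - s ^ 2 / (2 * π) = (t - s) * ((t + s) / (2 * π)) := by
    field_simp; ring
  have h4 : 2 * |m| < (t + s) / (2 * π) := by
    rw [lt_div_iff₀ (by positivity)]
    linarith
  nlinarith [mul_lt_mul_of_pos_left h4 (sub_pos.2 hst)]

lemma exists_root {m q f : ℝ} (hq : 0 ≤ q) (h : 0 < q + |f|) :
    ∃ t, 0 < t ∧ 2 * |2 * f + t * m| = t ^ 2 / (2 * π) - 2 * π * q := by
  have hpi := Real.pi_pos
  set φ : ℝ → ℝ := fun t => t ^ 2 / (2 * π) - 2 * π * q - 2 * |2 * f + t * m| with hφ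
  have hφc : Continuous φ := by fun_prop
  set L : ℝ := 2 * π * (1 + q * (2 * π) + 4 * |f| + 2 * |m|) with hL
  have hL0 : 0 ≤ L := by positivity
  have h0 : φ 0 < 0 := by
    simp only [hφ, zero_mul, add_zero, abs_mul, abs_two]
    rcases hq.eq_or_lt with h1 | h1
    · rw [← h1] at h ⊢
      norm_num
      simpa using h
    · have := abs_nonneg f
      have := mul_pos hpi h1
      norm_num
      linarith
  have hLφ : 0 ≤ φ L := by
    have h1 := abs_add_mul_le f m 0 L
    simp only [zero_mul, add_zero, sub_zero, abs_mul, abs_two, abs_of_nonneg hL0] at h1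
    have h2 : L ^ 2 / (2 * π) = L * (1 + q * (2 * π) + 4 * |f| + 2 * |m|) := by
      rw [hL]; field_simp
    have h3 : 1 ≤ L := by
      have : 1 ≤ 1 + q * (2 * π) + 4 * |f| + 2 * |m| := by
        have : 0 ≤ q * (2 * π) + 4 * |f| + 2 * |m| := by positivity
        linarith
      rw [hL]
      nlinarith [Real.pi_gt_three]
    have h4 : 0 ≤ q * (2 * π) + 4 * |f| := by positivity
    simp only [hφ]
    rw [h2]
    nlinarith [mul_le_mul_of_nonneg_right h3 h4]
  obtain ⟨t, ht, hte⟩ := intermediate_value_Icc hL0 hφc.continuousOn ⟨h0.le, hLφ⟩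
  have ht0 : t ≠ 0 := by
    rintro rfl
    exact h0.ne hte
  refine ⟨t, lt_of_le_of_ne ht.1 ht0.symm, ?_⟩
  simp only [hφ] at hte
  linarith

/-- Past the root the slack grows by at least (T - t)((T + t)/4 - π|m|). Using t ≥ 2π|m| and T ≥ 2πn
+ 4π, the second factor is at least π(n - |m|)/2 + π; the first is at least 4π, and the product
absorbs the error terms. -/
lemma bound_after_root {m q f n t T : ℝ} (hmq : m ^ 2 ≤ q) (hmn : |m| ≤ n) (ht0 : 0 < t)
    (ht : 2 * |2 * f + t * m| = t ^ 2 / (2 * π) - 2 * π * q) (hT : t + 4 * π ≤ T)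
    (hT' : 2 * π * n + 4 * π ≤ T) :
    π * |2 * f + T * m| + 2 * π ^ 2 * (n - |m|) + π ^ 2 ≤ T ^ 2 / 4 - π ^ 2 * q := by
  have hpi := Real.pi_pos
  have h1 := two_pi_mul_abs_le_of_root hmq ht0 ht
  have h2 := abs_add_mul_le f m t T
  rw [abs_of_pos (by linarith : 0 < T - t)] at h2
  have h3 : π * |2 * f + t * m| = t ^ 2 / 4 - π ^ 2 * q := by
    have : π * |2 * f + t * m| = π / 2 * (2 * |2 * f + t * m|) := by ring
    rw [this, ht]
    field_simp
    ring
  have h4 := mul_le_mul_of_nonneg_left h2 hpi.le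
  rw [mul_add, h3] at h4
  have h5 : π * (n - |m|) / 2 + π ≤ (T + t) / 4 - π * |m| := by linarith
  have h6 : 4 * π * (π * (n - |m|) / 2 + π) ≤ (T - t) * ((T + t) / 4 - π * |m|) := by
    apply mul_le_mul (by linarith) h5 _ (by linarith)
    have := mul_nonneg hpi.le (sub_nonneg.2 hmn)
    linarith
  nlinarith [sq_nonneg π]

/-- Subtracting the equation at t from the inequality at T, with π|m| ≤ T/2, leaves exactly (t -
T)²/4 ≤ 4πT + 10π². No linear term in t - T survives. -/
lemma root_sub_sq_le {m q f t T : ℝ} (ht : 2 * |2 * f + t * m| = t ^ 2 / (2 * π) - 2 * π * q)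
    (hTt : T ≤ t) (hT : 2 * π * |m| ≤ T)
    (h : π * |2 * f + T * m| ≤ T ^ 2 / 4 - π ^ 2 * q + 4 * π * T + 10 * π ^ 2) :
    (t - T) ^ 2 ≤ 16 * π * T + 40 * π ^ 2 := by
  have hpi := Real.pi_pos
  have h2 := abs_add_mul_le f m T t
  rw [abs_of_nonneg (sub_nonneg.2 hTt)] at h2
  have h3 : π * |2 * f + t * m| = t ^ 2 / 4 - π ^ 2 * q := by
    have : π * |2 * f + t * m| = π / 2 * (2 * |2 * f + t * m|) := by ring
    rw [this, ht]
    field_simp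
    ring
  have h4 := mul_le_mul_of_nonneg_left h2 hpi.le
  rw [h3] at h4
  nlinarith [mul_le_mul_of_nonneg_left hT (sub_nonneg.2 hTt)]

/-! ### Comparison of the reach time with max(T₀, T₁) -/

lemma stateSize_le {F : LInf} {f t M : ℝ} (ht : IsTimeT1 F f t) (htM : t ≤ M)
    (hM : timeT0 F ≤ M) : stateSize F f ≤ M := by
  obtain ⟨ht0, ht⟩ := ht
  rw [timeT0] at hM
  have hpi := Real.pi_gt_three
  have hn := norm_nonneg F
  have hm := abs_circMean_le F
  have hM0 : 0 < M := ht0.trans_le htM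
  have hq : 0 ≤ circMean fun z => F z ^ 2 := (sq_nonneg _).trans (circMean_sq_le F)
  have hnM : ‖F‖ ≤ M / 6 := by nlinarith
  have h1 := abs_add_mul_le f (circMean F) t 0
  simp only [zero_mul, add_zero, zero_sub, abs_neg, abs_mul, abs_two, abs_of_pos ht0] at h1
  have h2 : t ^ 2 / (2 * π) ≤ M ^ 2 / 6 :=
    div_le_div₀ (by positivity) (pow_le_pow_left₀ ht0.le htM 2) (by norm_num) (by linarith)
  have h3 : t * |circMean F| ≤ M * (M / 6) :=
    mul_le_mul htM (hm.trans hnM) (abs_nonneg _) hM0.le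
  have h4 : |f| ≤ (M / 2) ^ 2 := by nlinarith [mul_nonneg Real.pi_pos.le hq]
  have h5 : |f| ^ (1 / 2 : ℝ) ≤ M / 2 := by
    rw [← Real.sqrt_eq_rpow]
    exact Real.sqrt_le_iff.2 ⟨by positivity, h4⟩
  rw [stateSize]
  linarith

lemma exists_isTimeT1 {F : LInf} {f : ℝ} (h : 0 < stateSize F f) :
    ∃ t, IsTimeT1 F f t ∧ ∀ s, IsTimeT1 F f s → s = t := by
  have hmq := circMean_sq_le F
  have hq : 0 ≤ circMean fun z => F z ^ 2 := (sq_nonneg _).trans hmq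
  have hpos : 0 < circMean (fun z => F z ^ 2) + |f| := by
    by_contra! hle
    have hq0 : circMean (fun z => F z ^ 2) = 0 := by linarith [abs_nonneg f]
    have hf0 : |f| = 0 := by linarith [abs_nonneg f]
    rw [stateSize, norm_eq_zero_of_circMean_sq_eq_zero hq0, hf0,
      Real.zero_rpow (by norm_num)] at h
    simp at h
  obtain ⟨t, ht0, ht⟩ := exists_root (m := circMean F) hq hpos
  exact ⟨t, ⟨ht0, ht⟩, fun s hs =>
    le_antisymm (root_unique hmq ht0 ht hs.2) (root_unique hmq hs.1 hs.2 ht)⟩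

lemma exists_mem_reachTimes {F : LInf} {f t M : ℝ} (ht : IsTimeT1 F f t) (htM : t ≤ M)
    (hM : timeT0 F ≤ M) : ∃ T ∈ reachTimes F f, T ≤ M + 6 * π := by
  have hpi := Real.pi_pos
  have hM0 : 0 < M := ht.1.trans_le htM
  rw [timeT0] at hM
  -- The margin 4π is the one `bound_after_root` asks for; rounding up to full turns adds at most
  -- 2π.
  set N := ⌈(M + 4 * π) / (2 * π)⌉₊ with hN_def
  have hN : M + 4 * π ≤ 2 * π * N := by
    have := Nat.le_ceil ((M + 4 * π) / (2 * π))
    rwa [div_le_iff₀' (by positivity)] at this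
  have hN' : 2 * π * N ≤ M + 6 * π := by
    have := (Nat.ceil_lt_add_one (a := (M + 4 * π) / (2 * π)) (by positivity)).le
    calc 2 * π * N ≤ 2 * π * ((M + 4 * π) / (2 * π) + 1) := by gcongr
      _ = M + 6 * π := by field_simp; ring
  refine ⟨2 * π * N, ⟨by positivity, mem_reachableSet_of_le ?_ ?_⟩, hN'⟩
  · have : 2 * π * ‖F‖ ≤ 2 * π * N := by linarith
    exact le_of_mul_le_mul_left this (by positivity)
  · have := bound_after_root (T := 2 * π * N) (circMean_sq_le F) (abs_circMean_le F) ht.1 ht.2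
      (by linarith) (by linarith)
    refine this.trans (le_of_eq ?_)
    ring

lemma sub_sqrt_le_of_mem_reachTimes {F : LInf} {f t T : ℝ} (ht : IsTimeT1 F f t)
    (hM : 1 ≤ max (timeT0 F) t) (hT : T ∈ reachTimes F f) :
    max (timeT0 F) t - 22 * √(max (timeT0 F) t) ≤ T := by
  obtain ⟨hT0, hT⟩ := hT
  obtain ⟨h1, h2, h3⟩ := bounds_of_mem_reachableSet hT0 hT
  have hpi := Real.pi_pos
  have hpi' := Real.pi_lt_d2
  set M := max (timeT0 F) t with hM_def
  have hs : 1 ≤ √M := Real.one_le_sqrt.2 hM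
  rcases le_total t T with htT | hTt
  · have : M ≤ T + 2 * π := max_le h1 (by linarith)
    linarith
  · have h4 := root_sub_sq_le ht.2 hTt h2 h3
    have htM : t ≤ M := le_max_right _ _
    -- As T ≤ M and 1 ≤ M, the bound is at most (16π + 40π²)M, and 16π + 40π² < 22².
    have h5 : (t - T) ^ 2 ≤ (22 * √M) ^ 2 := by
      rw [mul_pow, Real.sq_sqrt (by linarith)]
      nlinarith
    have h6 : t - T ≤ 22 * √M :=
      (le_abs_self _).trans (abs_le_of_sq_le_sq h5 (by positivity))
    have : M ≤ T + 22 * √M := max_le (by rw [timeT0]; linarith) (by linarith)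
    linarith

end

theorem mainTheorem2 :
    ∃ C : ℝ, 0 < C ∧ ∀ (F : LInf) (f : ℝ), C ≤ stateSize F f →
      (reachTimes F f).Nonempty ∧
      ∃ T₁ : ℝ, IsTimeT1 F f T₁ ∧ (∀ t : ℝ, IsTimeT1 F f t → t = T₁) ∧
        1 - C * stateSize F f ^ (-(1 / 2) : ℝ) ≤ minReachTime F f / max (timeT0 F) T₁ ∧
        minReachTime F f / max (timeT0 F) T₁ ≤ 1 + C * stateSize F f ^ (-1 : ℝ) := by
  -- The constant 22 comes from the lower bound and also exceeds the 6π of the upper bound.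
  refine ⟨22, by norm_num, fun F f hS => ?_⟩
  have hS0 : 0 < stateSize F f := by linarith
  obtain ⟨t, ht, huniq⟩ := exists_isTimeT1 hS0
  set S := stateSize F f with hS_def
  set M := max (timeT0 F) t with hM_def
  have hSM : S ≤ M := stateSize_le ht (le_max_right _ _) (le_max_left _ _)
  have hM0 : 0 < M := hS0.trans_le hSM
  obtain ⟨T, hT, hTM⟩ := exists_mem_reachTimes ht (le_max_right (timeT0 F) t) (le_max_left _ _)
  rw [← hM_def] at hTM
  refine ⟨⟨T, hT⟩, t, ht, huniq, ?_, ?_⟩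
  · have h1 : M - 22 * √M ≤ minReachTime F f :=
      le_csInf ⟨T, hT⟩ fun T' hT' => sub_sqrt_le_of_mem_reachTimes ht (by linarith) hT'
    rw [le_div_iff₀ hM0, Real.rpow_neg hS0.le, ← Real.sqrt_eq_rpow]
    have h2 : √M ≤ (√S)⁻¹ * M := by
      rw [inv_mul_eq_div, le_div_iff₀ (Real.sqrt_pos.2 hS0)]
      calc √M * √S ≤ √M * √M := by gcongr
        _ = M := Real.mul_self_sqrt hM0.le
    nlinarith
  · have h1 : minReachTime F f ≤ M + 6 * π := (csInf_le ⟨0, fun _ h => h.1⟩ hT).trans hTM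
    rw [div_le_iff₀ hM0, Real.rpow_neg_one]
    have h2 : 1 ≤ S⁻¹ * M := by
      rw [inv_mul_eq_div, le_div_iff₀ hS0]
      linarith
    nlinarith [Real.pi_lt_d2]
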